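/- Let $dS_3=\{x\in\mathbb R^{4} : -(x^0)^2+(x^1)^2+(x^2)^2+(x^3)^2=1\}$ be the unit hyperboloid with the metric $h^{(0)}_{ab}$ induced by the Minkowski metric. In the coordinates $x^0=\sinh\tau$, $x^k=\cosh\tau\, f_{(k)}$ ($k=1,2,3$), with $f_{(1)}=\cos\theta$, $f_{(2)}=\sin\theta\cos\phi$, $f_{(3)}=\sin\theta\sin\phi$, this metric is $-d\tau^2+\cosh^2\tau\,(d\theta^2+\sin^2\theta\,d\phi^2)$. Let $\mathcal D$ be its Levi-Civita connection and $\square=\mathcal D^a\mathcal D_a$. Let $n\ge 3$ be an integer and let $T_{ab}$ be a real tensor field that is smooth on all of $dS_3$, symmetric, divergence-free ($\mathcal D^bT_{ab}=0$) and traceless ($h_{(0)}^{ab}T_{ab}=0$), and satisfies $$(\square+n^2-2n-2)\,T_{ab}=0 .$$ Then for every smooth spacelike Cauchy surface $S$ of $dS_3$ (a spacelike graph $\tau=F(\theta,\phi)$ of a smooth function $F$ on the two-sphere, e.g. a slice $\tau=\mathrm{const}$), with future-directed timelike unit normal $n^a$ and induced area element $d^2S$, $$\int_S T_{ab}\,\zeta^a_{(l)}\,n^b\,d^2S=0\quad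 (l=0,1,2,3),\qquad \int_S T_{ab}\,\xi^a_{(0)}\,n^b\,d^2S=0 .$$ Here $\zeta^a_{(l)}=\mathcal D^a\zeta_{(l)}$ are the four translation (conformal Killing) vectors, with $\zeta_{(0)}=\sinh\tau$ and $\zeta_{(k)}=\cosh\tau\,f_{(k)}$ for $k=1,2,3$, and $\xi^a_{(0)}$ is any of the six Killing vectors of $dS_3$: the three rotations $x^2\partial_3-x^3\partial_2$, $x^3\partial_1-x^1\partial_3$, $x^1\partial_2-x^2\partial_1$ and the three boosts $x^k\partial_0+x^0\partial_k$, $k=1,2,3$. -/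

import Mathlib

open scoped ContDiff

noncomputable section

namespace DeSitter

/-- The ambient space `ℝ⁴` with coordinates `x⁰, x¹, x², x³` (only its topology and its linear
structure are used; the Minkowski form is `eta`). -/
abbrev E : Type := Fin 4 → ℝ

/-- The diagonal entries `-1, 1, 1, 1` of the Minkowski metric (and of its inverse). -/
def sgn (μ : Fin 4) : ℝ := if μ = 0 then -1 else 1

/-- `etaL x` is the linear form `y ↦ η(x, y) = -x⁰y⁰ + x¹y¹ + x²y² + x³y³`. -/
def etaL (x : E) : E →L[ℝ] ℝ :=
  ∑ μ : Fin 4, (sgn μ * x μ) • (ContinuousLinearMap.proj μ : E →L[ℝ] ℝ)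

/-- The Minkowski form on `ℝ⁴`. -/
def eta (x y : E) : ℝ := etaL x y

/-- The standard basis vectors of `ℝ⁴`. -/
def e (μ : Fin 4) : E := Pi.single μ 1

/-- The unit hyperboloid `dS₃ = {x | η(x, x) = 1}`. With `x = coordPt τ θ φ` (see below) the metric
induced by `η` is `-dτ² + cosh² τ (dθ² + sin² θ dφ²)`. -/
def dS3 : Set E := {x | eta x x = 1}

/-- The open region of spacelike vectors, a neighbourhood of `dS3`. -/
def spacelikeRegion : Set E := {x | 0 < eta x x}

/-- The radial retraction of `spacelikeRegion` onto `dS3`. -/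
def retr (y : E) : E := (Real.sqrt (eta y y))⁻¹ • y

/-- For `x ∈ dS3`, the `η`-orthogonal projection `v ↦ v - η(x, v) x` onto the tangent space
`{v | η(x, v) = 0}` of `dS3` at `x`. -/
def tanProj (x : E) : E →L[ℝ] E :=
  ContinuousLinearMap.id ℝ E - (etaL x).smulRight x

/-- A covariant tensor field of rank `k`. Only its values on `dS3` are ever used. Tensor fields of
the hyperboloid itself are those which are tangential, see `IsTangential`. -/
abbrev TensorField (k : ℕ) : Type := E → (E [×k]→L[ℝ] ℝ)

/-- The tensor vanishes as soon as one argument is the normal vector `x` of `dS3` at `x`; such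
ambient tensors are in bijection with tensors on the tangent spaces of `dS3`. -/
def IsTangential {k : ℕ} (T : TensorField k) : Prop :=
  ∀ x ∈ dS3, ∀ (v : Fin k → E) (i : Fin k), v i = x → T x v = 0

/-- `T` is regular: it is smooth on the whole of `dS3`. -/
def IsRegular {k : ℕ} (T : TensorField k) : Prop :=
  ContDiffOn ℝ ∞ (fun y => T (retr y)) spacelikeRegion

/-- The covariant derivative of the Levi-Civita connection of `dS3`: the tangential projection
(in all arguments) of the flat derivative in `ℝ⁴`, the new argument being the first,
`(DT)(u, v₁, …, vₖ) = (D_u T)(v₁, …, vₖ)`. -/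
def covDeriv {k : ℕ} (T : TensorField k) : TensorField (k + 1) := fun x =>
  ((fderiv ℝ (fun y => T (retr y)) x).uncurryLeft).compContinuousLinearMap (fun _ => tanProj x)

/-- The gradient `D^a f` of a scalar field `f` on `dS3`, a tangent vector field. -/
def grad (f : E → ℝ) (x : E) : E := fun μ =>
  sgn μ * fderiv ℝ (fun y => f (retr y)) x (tanProj x (e μ))

/-- `D^b T_{ba}` evaluated on the vector `w`. (On tensors which vanish on the normal vector,
contraction with the inverse Minkowski metric is contraction with the inverse metric of `dS3`.) -/
def divergence (T : TensorField 2) (x w : E) : ℝ :=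
  ∑ μ : Fin 4, sgn μ * covDeriv T x ![e μ, e μ, w]

/-- The trace of `T` with respect to the metric of `dS3`, for tangential `T`. -/
def trace (T : TensorField 2) (x : E) : ℝ :=
  ∑ μ : Fin 4, sgn μ * T x ![e μ, e μ]

/-- `(□T)(v, w)`, with `□ = D^c D_c`. -/
def box (T : TensorField 2) (x v w : E) : ℝ :=
  ∑ μ : Fin 4, sgn μ * covDeriv (covDeriv T) x ![e μ, e μ, v, w]

/-- Regular symmetric divergence-free traceless tensors on `dS3`. -/
structure IsRegularSDT (T : TensorField 2) : Prop where
  tangential : IsTangential T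
  regular : IsRegular T
  symm : ∀ x ∈ dS3, ∀ v w : E, T x ![v, w] = T x ![w, v]
  divFree : ∀ x ∈ dS3, ∀ w : E, divergence T x w = 0
  traceless : ∀ x ∈ dS3, trace T x = 0

/-- The point of the unit two-sphere with polar angle `θ` and azimuth `φ`, the polar axis being the
first one; its components are `f₁ = cos θ`, `f₂ = sin θ cos φ`, `f₃ = sin θ sin φ`. -/
def spherePt (θ φ : ℝ) : Fin 3 → ℝ :=
  ![Real.cos θ, Real.sin θ * Real.cos φ, Real.sin θ * Real.sin φ]

/-- Global coordinates `(τ, θ, φ)` on `dS3`. -/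
def coordPt (τ θ φ : ℝ) : E :=
  ![Real.sinh τ, Real.cosh τ * spherePt θ φ 0, Real.cosh τ * spherePt θ φ 1,
    Real.cosh τ * spherePt θ φ 2]

/-- The coordinate `τ` of a point of `dS3`. -/
def timeCoord (x : E) : ℝ := Real.arsinh (x 0)

/-- The point of the unit sphere determined by a point of `dS3`. -/
def sphereCoord (x : E) : Fin 3 → ℝ := fun i => (Real.cosh (timeCoord x))⁻¹ * x i.succ

/-- The function `τ - F` on `dS3`, for a function `F` on the two-sphere. -/
def height (F : (Fin 3 → ℝ) → ℝ) (x : E) : ℝ := timeCoord x - F (sphereCoord x)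

/-- A smooth spacelike Cauchy surface of `dS3`, i.e. a graph `τ = F(θ, φ)` over the two-sphere, with
`F` smooth (given as the restriction to the sphere of a smooth function on `ℝ³`), whose normal
vector is timelike everywhere. The slices `τ = const` are the constant functions `F`. -/
structure CauchySurface where
  F : (Fin 3 → ℝ) → ℝ
  smooth : ContDiff ℝ ∞ F
  spacelike : ∀ x ∈ dS3, height F x = 0 →
    eta (grad (height F) x) (grad (height F) x) < 0

/-- The parametrization of the Cauchy surface by the angles. -/
def CauchySurface.pt (S : CauchySurface) (θ φ : ℝ) : E := coordPt (S.F (spherePt θ φ)) θ φ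

/-- The future-directed timelike unit normal vector `n^a` of the Cauchy surface, i.e.
`- grad (τ - F)` normalized; it is `∂_τ` on the slices `τ = const`. -/
def CauchySurface.normal (S : CauchySurface) (x : E) : E :=
  -((Real.sqrt (-eta (grad (height S.F) x) (grad (height S.F) x)))⁻¹ • grad (height S.F) x)

/-- The density of the induced area element `d²S` with respect to `dθ dφ`: the square root of the
determinant of the induced metric. -/
def CauchySurface.areaDensity (S : CauchySurface) (θ φ : ℝ) : ℝ :=
  let Xθ : E := deriv (fun t => S.pt t φ) θ
  let Xφ : E := deriv (fun t => S.pt θ t) φ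
  Real.sqrt (eta Xθ Xθ * eta Xφ Xφ - eta Xθ Xφ ^ 2)

/-- The charge `∫_S T_{ab} ξ^a n^b d²S`. -/
def charge (T : TensorField 2) (ξ : E → E) (S : CauchySurface) : ℝ :=
  ∫ θ in (0 : ℝ)..Real.pi, ∫ φ in (0 : ℝ)..(2 * Real.pi),
    T (S.pt θ φ) ![ξ (S.pt θ φ), S.normal (S.pt θ φ)] * S.areaDensity θ φ

/-- The functions `ζ₍₀₎ = sinh τ` and `ζ₍ₖ₎ = cosh τ fₖ` (`k = 1, 2, 3`) on `dS3`. -/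
def zeta (l : Fin 4) (x : E) : ℝ := x l

/-- The four translation (conformal Killing) vectors `D^a ζ₍ₗ₎`. -/
def translation (l : Fin 4) : E → E := grad (zeta l)

/-- The three rotation Killing vectors: `rotation 0 = x²∂₃ - x³∂₂ = ∂_φ`, and cyclically. -/
def rotation : Fin 3 → E → E
  | 0 => fun x => x 2 • e 3 - x 3 • e 2
  | 1 => fun x => x 3 • e 1 - x 1 • e 3
  | 2 => fun x => x 1 • e 2 - x 2 • e 1

/-- The three boost Killing vectors `xᵏ∂₀ + x⁰∂ₖ`, `k = 1, 2, 3`; in the coordinates `(τ, θ, φ)`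
this is `fₖ ∂_τ + tanh τ grad_{S²} fₖ`. -/
def boost (k : Fin 3) : E → E := fun x => x k.succ • e 0 + x 0 • e k.succ

end DeSitter

end

namespace DeSitter

/-! The conserved current `J_ν = ξ^μ T_{μν}` is exact, so its flux through a closed surface
vanishes. Extend the Cartesian components of `T` to the spacelike region of `ℝ⁴` as homogeneous
functions of degree zero. Tangentiality, tracelessness and vanishing divergence make the flat
divergence vanish, and the wave equation `□T + mT = 0` becomes `∂²T = -(m + 2) T` on `dS3`,
componentwise (`divergence_eq'`, `dAlembert_component_of_box`). Since `T` annihilates the normal, a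
translation may be replaced by a constant field on `ℝ⁴`; a Killing vector is already a linear field.
Let `ξ` be such a field, of homogeneity degree `α = 0` or `α = 1`, and put `C_{ρν} = ξ^μ ∂_ρ T_{μν}
- (∂_ρ ξ^μ) T_{μν}`. For the one-form `W = vol(y, e^ρ, e^ν, ·) C_{ρν}`, the restriction of `dW` to
tangent vectors of `dS3` is `α² - 1 - (m + 2)` times the flux form of `J`, up to sign
(`sum_vol_antisymm_deriv_eq_flux`). Stokes' theorem on the sphere `S`
(`integral_exterior_deriv_eq_zero`) then kills the charge unless this factor is zero. For `m = n² -
2n - 2` the factor is `-(n - 1)²` for translations and `-n(n - 2)` for Killing vectors, both nonzero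
when `n ≥ 3`. -/

/-! ### Linear algebra of the Minkowski form and the volume form. -/

theorem eta_apply (x y : E) :
    eta x y = -(x 0 * y 0) + x 1 * y 1 + x 2 * y 2 + x 3 * y 3 := by
  simp [eta, etaL, sgn, Fin.sum_univ_four]

theorem etaL_apply (x y : E) : etaL x y = eta x y := rfl

theorem eta_comm (x y : E) : eta x y = eta y x := by
  rw [eta_apply, eta_apply]; ring

theorem sgn_mul_self (μ : Fin 4) : sgn μ * sgn μ = 1 := by
  unfold sgn; split_ifs <;> norm_num

theorem eta_e (x : E) (μ : Fin 4) : eta x (e μ) = sgn μ * x μ := by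
  fin_cases μ <;> simp [eta_apply, e, sgn]

theorem eta_smul_left (c : ℝ) (x y : E) : eta (c • x) y = c * eta x y := by
  simp [eta_apply]; ring

theorem eta_smul_right (c : ℝ) (x y : E) : eta x (c • y) = c * eta x y := by
  simp [eta_apply]; ring

theorem sum_smul_e (v : E) : ∑ μ, v μ • e μ = v := by
  ext i; fin_cases i <;> simp [Fin.sum_univ_four, e]

theorem clm_apply_eq_sum (D : E →L[ℝ] ℝ) (v : E) : D v = ∑ μ, v μ * D (e μ) := by
  conv_lhs => rw [← sum_smul_e v]
  simp only [map_sum, map_smul, smul_eq_mul]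

/-- The volume form of `ℝ⁴`. -/
noncomputable def vol (a b c d : E) : ℝ := Matrix.det (Matrix.of ![a, b, c, d])

theorem vol_apply (a b c d : E) : vol a b c d =
    a 0 * (b 1 * (c 2 * d 3 - c 3 * d 2) - b 2 * (c 1 * d 3 - c 3 * d 1)
      + b 3 * (c 1 * d 2 - c 2 * d 1))
    - a 1 * (b 0 * (c 2 * d 3 - c 3 * d 2) - b 2 * (c 0 * d 3 - c 3 * d 0)
      + b 3 * (c 0 * d 2 - c 2 * d 0))
    + a 2 * (b 0 * (c 1 * d 3 - c 3 * d 1) - b 1 * (c 0 * d 3 - c 3 * d 0)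
      + b 3 * (c 0 * d 1 - c 1 * d 0))
    - a 3 * (b 0 * (c 1 * d 2 - c 2 * d 1) - b 1 * (c 0 * d 2 - c 2 * d 0)
      + b 2 * (c 0 * d 1 - c 1 * d 0)) := by
  simp [vol, Matrix.det_succ_row_zero, Fin.sum_univ_succ, Fin.succAbove]
  ring

/-- The volume form as a linear form in its first argument. -/
noncomputable def volFst (b c d : E) : E →L[ℝ] ℝ :=
  LinearMap.toContinuousLinearMap
    (IsLinearMap.mk' (fun a => vol a b c d)
      ⟨fun x y => by simp only [vol_apply, Pi.add_apply]; ring,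
       fun r x => by simp only [vol_apply, Pi.smul_apply, smul_eq_mul]; ring⟩)

theorem volFst_apply (a b c d : E) : volFst b c d a = vol a b c d := rfl

/-- Five vectors of `ℝ⁴` are linearly dependent (Cramer's rule). -/
theorem clm_mul_vol (D : E →L[ℝ] ℝ) (z a b c d : E) :
    D z * vol a b c d = D a * vol z b c d + D b * vol a z c d + D c * vol a b z d
      + D d * vol a b c z := by
  rw [clm_apply_eq_sum D z, clm_apply_eq_sum D a, clm_apply_eq_sum D b, clm_apply_eq_sum D c,
    clm_apply_eq_sum D d]
  simp only [vol_apply, Fin.sum_univ_four]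
  ring

theorem vol_swap_fst_last (a b c d : E) : vol d b c a = -vol a b c d := by
  simp only [vol_apply]; ring

theorem vol_swap_mid (a b c d : E) : vol a c b d = -vol a b c d := by
  simp only [vol_apply]; ring

theorem vol_swap_last (a b c d : E) : vol a b d c = -vol a b c d := by
  simp only [vol_apply]; ring

theorem vol_swap_fst (a b c d : E) : vol b a c d = -vol a b c d := by
  simp only [vol_apply]; ring

/-- The antisymmetrized derivative of the one-form `i_x ⋆C`, where `C` is a tensor field of rank
two whose components are homogeneous of degree `k`. -/
theorem sum_vol_antisymm_deriv (c : Fin 4 → Fin 4 → ℝ) (D : Fin 4 → Fin 4 → E →L[ℝ] ℝ)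
    (x u v : E) (k : ℝ) (hD : ∀ ρ ν, D ρ ν x = k * c ρ ν) :
    ∑ ρ, ∑ ν, sgn ρ * sgn ν * (vol u (e ρ) (e ν) v * c ρ ν + vol x (e ρ) (e ν) v * D ρ ν u
        - (vol v (e ρ) (e ν) u * c ρ ν + vol x (e ρ) (e ν) u * D ρ ν v)) =
    (2 + k) * ∑ ρ, ∑ ν, sgn ρ * sgn ν * (vol u (e ρ) (e ν) v * c ρ ν) +
    (∑ ν, sgn ν * (∑ ρ, sgn ρ * D ρ ν (e ρ)) * vol x (e ν) v u
      - ∑ ρ, sgn ρ * (∑ ν, sgn ν * D ρ ν (e ν)) * vol x (e ρ) v u) := by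
  simp only [Finset.mul_sum, Finset.sum_mul]
  rw [Finset.sum_comm (f := fun ν ρ => sgn ν * (sgn ρ * D ρ ν (e ρ)) * vol x (e ν) v u)]
  simp only [← Finset.sum_add_distrib, ← Finset.sum_sub_distrib]
  refine Finset.sum_congr rfl fun ρ _ => Finset.sum_congr rfl fun ν _ => ?_
  -- This trades the derivative along `v` for those along `x` (Euler's relation, giving `k`), along
  -- `e ρ` and `e ν` (the two divergences) and along `u` (which cancels the other half of the
  -- antisymmetrization).
  have h := clm_mul_vol (D ρ ν) v x (e ρ) (e ν) u
  rw [hD] at h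
  rw [vol_swap_mid x (e ν) v u] at h
  rw [vol_swap_fst_last u (e ρ) (e ν) v] at h ⊢
  linear_combination (-sgn ρ * sgn ν) * h

/-- Cramer's rule for the form `η(x, ·)`: it vanishes on `u` and `v`, so only the terms with `e ρ`
or `e ν` replaced by `x` survive, and only the contractions of `c` with the normal contribute. -/
theorem sum_vol_of_tangent (c : Fin 4 → Fin 4 → ℝ) (x u v : E) (hx : eta x x = 1)
    (hu : eta x u = 0) (hv : eta x v = 0) :
    ∑ ρ, ∑ ν, sgn ρ * sgn ν * (vol u (e ρ) (e ν) v * c ρ ν) =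
    ∑ ν, sgn ν * (∑ ρ, x ρ * c ρ ν) * vol u x (e ν) v
      + ∑ ρ, sgn ρ * (∑ ν, x ν * c ρ ν) * vol u (e ρ) x v := by
  simp only [Finset.mul_sum, Finset.sum_mul]
  rw [Finset.sum_comm (f := fun ν ρ => sgn ν * (x ρ * c ρ ν) * vol u x (e ν) v)]
  simp only [← Finset.sum_add_distrib]
  refine Finset.sum_congr rfl fun ρ _ => Finset.sum_congr rfl fun ν _ => ?_
  have h := clm_mul_vol (etaL x) x u (e ρ) (e ν) v
  simp only [etaL_apply, hx, hu, hv, eta_e] at h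
  have h1 := sgn_mul_self ρ
  have h2 := sgn_mul_self ν
  linear_combination (sgn ρ * sgn ν * c ρ ν) * h + (sgn ν * x ρ * vol u x (e ν) v * c ρ ν) * h1
    + (sgn ρ * x ν * vol u (e ρ) x v * c ρ ν) * h2

/-- For tangent vectors `u, v` of the hyperboloid at `x`. -/
theorem sum_vol_antisymm_deriv_eq_flux (c : Fin 4 → Fin 4 → ℝ) (D : Fin 4 → Fin 4 → E →L[ℝ] ℝ)
    (J : Fin 4 → ℝ) (x u v : E) (k α l : ℝ) (hD : ∀ ρ ν, D ρ ν x = k * c ρ ν)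
    (hx : eta x x = 1) (hu : eta x u = 0) (hv : eta x v = 0)
    (h1 : ∀ ν, ∑ ρ, x ρ * c ρ ν = -α * J ν) (h2 : ∀ ρ, ∑ ν, x ν * c ρ ν = -J ρ)
    (h3 : ∀ ν, ∑ ρ, sgn ρ * D ρ ν (e ρ) = l * J ν) (h4 : ∀ ρ, ∑ ν, sgn ν * D ρ ν (e ν) = 0) :
    ∑ ρ, ∑ ν, sgn ρ * sgn ν * (vol u (e ρ) (e ν) v * c ρ ν + vol x (e ρ) (e ν) v * D ρ ν u
        - (vol v (e ρ) (e ν) u * c ρ ν + vol x (e ρ) (e ν) u * D ρ ν v)) =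
    ((2 + k) * (α - 1) + l) * ∑ ν, sgn ν * J ν * vol x (e ν) v u := by
  rw [sum_vol_antisymm_deriv c D x u v k hD, sum_vol_of_tangent c x u v hx hu hv]
  simp only [h1, h2, h3, h4]
  rw [← Finset.sum_add_distrib, ← Finset.sum_sub_distrib, Finset.mul_sum, Finset.mul_sum,
    ← Finset.sum_add_distrib]
  refine Finset.sum_congr rfl fun ν _ => ?_
  have e1 : vol u x (e ν) v = -vol x (e ν) v u := by simp only [vol_apply]; ring
  have e2 : vol u (e ν) x v = vol x (e ν) v u := by simp only [vol_apply]; ring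
  rw [e1, e2]; ring

/-- The Gram determinant of two tangent vectors is minus the square of their cross product. -/
theorem sum_sgn_mul_vol_sq (x u v : E) (hx : eta x x = 1) (hu : eta x u = 0)
    (hv : eta x v = 0) :
    ∑ μ, sgn μ * vol x (e μ) u v ^ 2 = -(eta u u * eta v v - eta u v ^ 2) := by
  have h : ∑ μ, sgn μ * vol x (e μ) u v ^ 2 = -(eta x x * (eta u u * eta v v - eta u v ^ 2)
      - eta x u * (eta x u * eta v v - eta u v * eta x v)
      + eta x v * (eta x u * eta u v - eta u u * eta x v)) := by
    simp [vol_apply, eta_apply, Fin.sum_univ_four, sgn, e]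
    ring
  rw [h, hx, hu, hv]; ring

/-! ### Tangential projection and radial retraction. -/

theorem tanProj_apply (x v : E) : tanProj x v = v - eta x v • x := by
  simp [tanProj, etaL_apply]

theorem eta_tanProj {x : E} (hx : x ∈ dS3) (v : E) : eta x (tanProj x v) = 0 := by
  have h : eta x x = 1 := hx
  rw [tanProj_apply, ← etaL_apply, map_sub, map_smul, etaL_apply, etaL_apply, h]; simp

theorem tanProj_of_tangent {x v : E} (hv : eta x v = 0) : tanProj x v = v := by
  simp [tanProj_apply, hv]

theorem tanProj_self {x : E} (hx : x ∈ dS3) : tanProj x x = 0 := by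
  have h : eta x x = 1 := hx
  simp [tanProj_apply, h]

theorem tanProj_tanProj {x : E} (hx : x ∈ dS3) (v : E) :
    tanProj x (tanProj x v) = tanProj x v :=
  tanProj_of_tangent (eta_tanProj hx v)

theorem contDiff_eta_self : ContDiff ℝ ∞ (fun y : E => eta y y) := by
  simp only [eta_apply]; fun_prop

theorem isOpen_spacelikeRegion : IsOpen spacelikeRegion :=
  isOpen_lt continuous_const contDiff_eta_self.continuous

theorem spacelikeRegion_mem_nhds {y : E} (hy : y ∈ spacelikeRegion) :
    spacelikeRegion ∈ nhds y := isOpen_spacelikeRegion.mem_nhds hy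

theorem dS3_subset_spacelikeRegion : dS3 ⊆ spacelikeRegion := by
  intro x hx
  have h : eta x x = 1 := hx
  simp [spacelikeRegion, h]

theorem retr_mem {y : E} (hy : y ∈ spacelikeRegion) : retr y ∈ dS3 := by
  have h : 0 < eta y y := hy
  change eta (retr y) (retr y) = 1
  have h2 := Real.sq_sqrt h.le
  have h3 : Real.sqrt (eta y y) ≠ 0 := (Real.sqrt_pos.2 h).ne'
  rw [retr, eta_smul_left, eta_smul_right]
  field_simp
  linarith

theorem retr_of_mem {x : E} (hx : x ∈ dS3) : retr x = x := by
  have h : eta x x = 1 := hx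
  simp [retr, h]

theorem retr_smul (y : E) {c : ℝ} (hc : 0 < c) : retr (c • y) = retr y := by
  have h2 : eta (c • y) (c • y) = c ^ 2 * eta y y := by
    rw [eta_smul_left, eta_smul_right]; ring
  rw [retr, retr, h2, Real.sqrt_mul (by positivity), Real.sqrt_sq hc.le, smul_smul, mul_inv,
    mul_assoc, mul_comm _ c, ← mul_assoc, inv_mul_cancel₀ hc.ne', one_mul]

theorem sqrt_smul_retr {y : E} (hy : y ∈ spacelikeRegion) :
    Real.sqrt (eta y y) • retr y = y := by
  have h3 : Real.sqrt (eta y y) ≠ 0 := (Real.sqrt_pos.2 hy).ne'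
  rw [retr, smul_smul, mul_inv_cancel₀ h3, one_smul]

theorem contDiffOn_retr : ContDiffOn ℝ ∞ retr spacelikeRegion := by
  intro y hy
  have h : 0 < eta y y := hy
  refine ContDiffAt.contDiffWithinAt ?_
  refine ContDiffAt.smul (ContDiffAt.inv (contDiff_eta_self.contDiffAt.sqrt h.ne') ?_)
    contDiffAt_id
  exact (Real.sqrt_pos.2 h).ne'

theorem contDiffAt_retr {y : E} (hy : y ∈ spacelikeRegion) : ContDiffAt ℝ ∞ retr y :=
  contDiffOn_retr.contDiffAt (spacelikeRegion_mem_nhds hy)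

theorem hasFDerivAt_eta_self (x : E) :
    HasFDerivAt (fun y : E => eta y y) ((2 : ℝ) • etaL x) x := by
  have h1 : ∀ i : Fin 4, HasFDerivAt (fun y : E => y i)
      (ContinuousLinearMap.proj i : E →L[ℝ] ℝ) x := fun i => hasFDerivAt_apply i x
  have := ((((h1 0).mul (h1 0)).neg.add ((h1 1).mul (h1 1))).add ((h1 2).mul (h1 2))).add
    ((h1 3).mul (h1 3))
  refine (this.congr_fderiv ?_).congr_of_eventuallyEq (Filter.Eventually.of_forall fun y => ?_)
  · ext v
    simp [etaL_apply, eta_apply]; ring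
  · exact eta_apply y y

theorem hasFDerivAt_retr {x : E} (hx : x ∈ dS3) : HasFDerivAt retr (tanProj x) x := by
  have h : eta x x = 1 := hx
  have h1 := (hasFDerivAt_eta_self x).sqrt (by rw [h]; norm_num)
  have h2 := (hasDerivAt_inv (x := Real.sqrt (eta x x)) (by rw [h]; norm_num)).comp_hasFDerivAt x h1
  have h3 := h2.smul (hasFDerivAt_id x)
  refine h3.congr_fderiv ?_
  ext1 v
  simp [h, tanProj_apply, etaL_apply]
  module

/-! ### Calculus of homogeneous functions of degree zero. -/

theorem contDiffAt_of_mem {F : Type*} [NormedAddCommGroup F] [NormedSpace ℝ F] {f : E → F}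
    (hf : ContDiffOn ℝ ∞ f spacelikeRegion) {y : E} (hy : y ∈ spacelikeRegion) :
    ContDiffAt ℝ ∞ f y := hf.contDiffAt (spacelikeRegion_mem_nhds hy)

theorem differentiableAt_of_mem {F : Type*} [NormedAddCommGroup F] [NormedSpace ℝ F] {f : E → F}
    (hf : ContDiffOn ℝ ∞ f spacelikeRegion) {y : E} (hy : y ∈ spacelikeRegion) :
    DifferentiableAt ℝ f y := (contDiffAt_of_mem hf hy).differentiableAt (by simp)

theorem contDiffOn_fderiv {F : Type*} [NormedAddCommGroup F] [NormedSpace ℝ F] {f : E → F}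
    (hf : ContDiffOn ℝ ∞ f spacelikeRegion) : ContDiffOn ℝ ∞ (fderiv ℝ f) spacelikeRegion :=
  hf.fderiv_of_isOpen isOpen_spacelikeRegion (by simp)

theorem contDiffOn_fderiv_apply {F : Type*} [NormedAddCommGroup F] [NormedSpace ℝ F] {f : E → F}
    (hf : ContDiffOn ℝ ∞ f spacelikeRegion) (u : E) :
    ContDiffOn ℝ ∞ (fun y => fderiv ℝ f y u) spacelikeRegion :=
  (contDiffOn_fderiv hf).clm_apply contDiffOn_const

theorem fderiv_fderiv_apply {f : E → ℝ} (hf : ContDiffOn ℝ ∞ f spacelikeRegion) {x : E}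
    (hx : x ∈ spacelikeRegion) (u v : E) :
    fderiv ℝ (fun y => fderiv ℝ f y u) x v = fderiv ℝ (fderiv ℝ f) x v u := by
  have h := (differentiableAt_of_mem (contDiffOn_fderiv hf) hx).hasFDerivAt.clm_apply
    (hasFDerivAt_const u x)
  rw [h.fderiv]; simp

/-- Functions on the spacelike region which are homogeneous of degree zero. -/
def IsHomogZero (f : E → ℝ) : Prop :=
  ∀ y ∈ spacelikeRegion, ∀ c : ℝ, 0 < c → f (c • y) = f y

theorem fderiv_smul_of_isHomogZero {f : E → ℝ} (hh : IsHomogZero f) {y : E}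
    (hy : y ∈ spacelikeRegion) {c : ℝ} (hc : 0 < c) :
    c • fderiv ℝ f (c • y) = fderiv ℝ f y := by
  rw [← fderiv_comp_smul]
  refine Filter.EventuallyEq.fderiv_eq ?_
  filter_upwards [spacelikeRegion_mem_nhds hy] with z hz
  exact hh z hz c hc

theorem fderiv_self_of_isHomogZero {f : E → ℝ} (hf : ContDiffOn ℝ ∞ f spacelikeRegion)
    (hh : IsHomogZero f) {y : E} (hy : y ∈ spacelikeRegion) : fderiv ℝ f y y = 0 := by
  have h1 : HasDerivAt (fun c : ℝ => c • y) y 1 := by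
    simpa using (hasDerivAt_id (1 : ℝ)).smul_const y
  have h2 : HasFDerivAt f (fderiv ℝ f y) ((1 : ℝ) • y) := by
    rw [one_smul]; exact (differentiableAt_of_mem hf hy).hasFDerivAt
  have h3 := h2.comp_hasDerivAt (1 : ℝ) h1
  refine h3.unique ((hasDerivAt_const (1 : ℝ) (f y)).congr_of_eventuallyEq ?_)
  filter_upwards [lt_mem_nhds (zero_lt_one : (0 : ℝ) < 1)] with c hc
  exact hh y hy c hc

/-- Differentiate Euler's relation `f'(y) y = 0`. -/
theorem fderiv_fderiv_self_of_isHomogZero {f : E → ℝ} (hf : ContDiffOn ℝ ∞ f spacelikeRegion)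
    (hh : IsHomogZero f) {x : E} (hx : x ∈ spacelikeRegion) (u : E) :
    fderiv ℝ (fderiv ℝ f) x u x = -fderiv ℝ f x u := by
  have h := (differentiableAt_of_mem (contDiffOn_fderiv hf) hx).hasFDerivAt.clm_apply
    (hasFDerivAt_id x)
  have h2 : HasFDerivAt (fun y => fderiv ℝ f y (id y)) (0 : E →L[ℝ] ℝ) x := by
    refine (hasFDerivAt_const (0 : ℝ) x).congr_of_eventuallyEq ?_
    filter_upwards [spacelikeRegion_mem_nhds hx] with z hz
    exact fderiv_self_of_isHomogZero hf hh hz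
  have h3 := congrArg (fun L : E →L[ℝ] ℝ => L u) (h.unique h2)
  simp at h3
  linarith

theorem two_le_infty : (2 : WithTop ℕ∞) ≤ ∞ :=
  WithTop.coe_le_coe.2 (le_top : (2 : ℕ∞) ≤ ⊤)

theorem fderiv_fderiv_comm {f : E → ℝ} (hf : ContDiffOn ℝ ∞ f spacelikeRegion)
    {x : E} (hx : x ∈ spacelikeRegion) (u v : E) :
    fderiv ℝ (fderiv ℝ f) x u v = fderiv ℝ (fderiv ℝ f) x v u :=
  ((contDiffAt_of_mem hf hx).isSymmSndFDerivAt (by simp [two_le_infty])).eq u v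

theorem sum_sgn_tanProj (B : E →L[ℝ] E →L[ℝ] ℝ) {x : E} (hx : x ∈ dS3) :
    ∑ μ, sgn μ * B (tanProj x (e μ)) (tanProj x (e μ)) = ∑ μ, sgn μ * B (e μ) (e μ) - B x x := by
  have h : eta x x = 1 := hx
  have hs : ∀ μ, sgn μ * sgn μ = 1 := sgn_mul_self
  have h1 : ∀ μ, sgn μ * B (tanProj x (e μ)) (tanProj x (e μ)) =
      sgn μ * B (e μ) (e μ) - x μ * B (e μ) x - x μ * B x (e μ)
        + (x μ * (sgn μ * x μ)) * B x x := by
    intro μ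
    simp only [tanProj_apply, eta_e, map_sub, map_smul, sub_apply,
      smul_apply, smul_eq_mul]
    linear_combination (-x μ * B (e μ) x - x μ * B x (e μ) + sgn μ * x μ * x μ * B x x) * hs μ
  have h2 : ∑ μ, x μ * B (e μ) x = B x x := (clm_apply_eq_sum (B.flip x) x).symm
  have h3 : ∑ μ, x μ * B x (e μ) = B x x := (clm_apply_eq_sum (B x) x).symm
  have h4 : ∑ μ, x μ * (sgn μ * x μ) = 1 := by
    rw [← h, eta_apply]; simp [Fin.sum_univ_four, sgn]
  simp only [h1, Finset.sum_add_distrib, Finset.sum_sub_distrib, h2, h3]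
  rw [← Finset.sum_mul, h4]; ring

/-- The flat d'Alembertian. -/
noncomputable def dAlembert (f : E → ℝ) (x : E) : ℝ :=
  ∑ μ, sgn μ * fderiv ℝ (fderiv ℝ f) x (e μ) (e μ)

/-- The two traces differ by the second radial derivative, which is zero by homogeneity. -/
theorem sum_sgn_tanProj_fderiv {f : E → ℝ} (hf : ContDiffOn ℝ ∞ f spacelikeRegion)
    (hh : IsHomogZero f) {x : E} (hx : x ∈ dS3) :
    ∑ μ, sgn μ * fderiv ℝ (fderiv ℝ f) x (tanProj x (e μ)) (tanProj x (e μ)) =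
      dAlembert f x := by
  have hx' := dS3_subset_spacelikeRegion hx
  rw [sum_sgn_tanProj _ hx, fderiv_fderiv_self_of_isHomogZero hf hh hx',
    fderiv_self_of_isHomogZero hf hh hx', dAlembert]
  ring

/-! ### Cartesian components of the tensor and their flat equations. -/

/-- A bilinear form as a linear form in its first argument. -/
noncomputable def fstForm (M : E [×2]→L[ℝ] ℝ) (w : E) : E →L[ℝ] ℝ :=
  (ContinuousMultilinearMap.apply ℝ (fun _ : Fin 1 => E) ℝ ![w]).comp M.curryLeft

theorem fstForm_apply (M : E [×2]→L[ℝ] ℝ) (v w : E) : fstForm M w v = M ![v, w] := rfl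

/-- A bilinear form as a linear form in its second argument. -/
noncomputable def sndForm (M : E [×2]→L[ℝ] ℝ) (v : E) : E →L[ℝ] ℝ :=
  (ContinuousMultilinearMap.apply ℝ (fun _ : Fin 0 => E) ℝ ![]).comp (M.curryLeft v).curryLeft

theorem sndForm_apply (M : E [×2]→L[ℝ] ℝ) (v w : E) : sndForm M v w = M ![v, w] := rfl

theorem bilin_eq_sum_left (M : E [×2]→L[ℝ] ℝ) (v w : E) :
    M ![v, w] = ∑ μ, v μ * M ![e μ, w] := clm_apply_eq_sum (fstForm M w) v

theorem bilin_eq_sum_right (M : E [×2]→L[ℝ] ℝ) (v w : E) :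
    M ![v, w] = ∑ μ, w μ * M ![v, e μ] := clm_apply_eq_sum (sndForm M v) w

theorem bilin_smul_left (M : E [×2]→L[ℝ] ℝ) (r : ℝ) (v w : E) :
    M ![r • v, w] = r * M ![v, w] := (fstForm M w).map_smul r v

theorem bilin_sub_smul (M : E [×2]→L[ℝ] ℝ) (r s : ℝ) (b c z : E) :
    M ![b - r • z, c - s • z] =
      M ![b, c] - r * M ![z, c] - s * M ![b, z] + r * s * M ![z, z] := by
  have h1 : ∀ w, M ![b - r • z, w] = M ![b, w] - r * M ![z, w] := fun w => by
    rw [← fstForm_apply, map_sub, map_smul]; rfl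
  have h2 : ∀ v, M ![v, c - s • z] = M ![v, c] - s * M ![v, z] := fun v => by
    rw [← sndForm_apply, map_sub, map_smul]; rfl
  rw [h1, h2, h2]; ring

/-- The component of `T` in the directions `b, c`, extended to the spacelike region as a homogeneous
function of degree zero. -/
noncomputable def component (T : TensorField 2) (b c : E) (y : E) : ℝ := T (retr y) ![b, c]

section Regular

variable {T : TensorField 2}

theorem contDiffOn_component (hT : IsRegular T) (b c : E) :
    ContDiffOn ℝ ∞ (component T b c) spacelikeRegion :=
  (ContinuousMultilinearMap.apply ℝ (fun _ : Fin 2 => E) ℝ ![b, c]).contDiff.comp_contDiffOn hT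

theorem isHomogZero_component (T : TensorField 2) (b c : E) : IsHomogZero (component T b c) :=
  fun y _ r hr => by simp only [component, retr_smul y hr]

theorem fderiv_component (hT : IsRegular T) (b c : E) {y : E} (hy : y ∈ spacelikeRegion) (u : E) :
    fderiv ℝ (component T b c) y u = fderiv ℝ (fun y => T (retr y)) y u ![b, c] := by
  have h := (differentiableAt_of_mem hT hy).hasFDerivAt.continuousMultilinear_apply_const ![b, c]
  have h2 : fderiv ℝ (component T b c) y = _ := h.fderiv
  rw [h2]; rfl

theorem component_eq_sum_left (T : TensorField 2) (b c y : E) :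
    component T b c y = ∑ μ, b μ * component T (e μ) c y := bilin_eq_sum_left _ _ _

theorem component_eq_sum_right (T : TensorField 2) (b c y : E) :
    component T b c y = ∑ μ, c μ * component T b (e μ) y := bilin_eq_sum_right _ _ _

theorem fderiv_component_eq_sum_left (hT : IsRegular T) (b c : E) {y : E}
    (hy : y ∈ spacelikeRegion) (u : E) :
    fderiv ℝ (component T b c) y u = ∑ μ, b μ * fderiv ℝ (component T (e μ) c) y u := by
  simp only [fderiv_component hT _ _ hy]
  exact bilin_eq_sum_left _ _ _

theorem component_comm (hs : ∀ x ∈ dS3, ∀ v w : E, T x ![v, w] = T x ![w, v]) (b c : E) {y : E}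
    (hy : y ∈ spacelikeRegion) : component T b c y = component T c b y :=
  hs _ (retr_mem hy) b c

theorem fderiv_component_comm (hs : ∀ x ∈ dS3, ∀ v w : E, T x ![v, w] = T x ![w, v]) (b c : E)
    {y : E} (hy : y ∈ spacelikeRegion) :
    fderiv ℝ (component T b c) y = fderiv ℝ (component T c b) y := by
  refine Filter.EventuallyEq.fderiv_eq ?_
  filter_upwards [spacelikeRegion_mem_nhds hy] with z hz
  exact component_comm hs b c hz

theorem component_self_left (ht : IsTangential T) (c : E) {y : E} (hy : y ∈ spacelikeRegion) :
    component T y c y = 0 := by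
  have h : component T (Real.sqrt (eta y y) • retr y) c y = 0 := by
    rw [component, bilin_smul_left, ht _ (retr_mem hy) ![retr y, c] 0 rfl, mul_zero]
  rwa [sqrt_smul_retr hy] at h

/-- Differentiate `z^μ T_{μc}(z) = 0`. On the left the slot `y` is frozen, so the derivative of the
factor `z^μ` moves to the right with a minus sign. -/
theorem fderiv_component_self_left (hr : IsRegular T) (ht : IsTangential T) (c : E) {y : E}
    (hy : y ∈ spacelikeRegion) (u : E) :
    fderiv ℝ (component T y c) y u = -component T u c y := by
  have h1 : HasFDerivAt (fun z : E => ∑ μ, z μ * component T (e μ) c z)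
      (∑ μ, (y μ • fderiv ℝ (component T (e μ) c) y
        + component T (e μ) c y • (ContinuousLinearMap.proj μ : E →L[ℝ] ℝ))) y :=
    HasFDerivAt.fun_sum fun μ _ => (hasFDerivAt_apply μ y).mul
      (differentiableAt_of_mem (contDiffOn_component hr _ _) hy).hasFDerivAt
  have h2 : HasFDerivAt (fun z : E => ∑ μ, z μ * component T (e μ) c z) (0 : E →L[ℝ] ℝ) y := by
    refine (hasFDerivAt_const (0 : ℝ) y).congr_of_eventuallyEq ?_
    filter_upwards [spacelikeRegion_mem_nhds hy] with z hz
    rw [← component_eq_sum_left, component_self_left ht c hz]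
  have h3 := congrArg (fun L : E →L[ℝ] ℝ => L u) (h1.unique h2)
  simp only [sum_apply, add_apply, smul_apply, smul_eq_mul,
    ContinuousLinearMap.proj_apply, Finset.sum_add_distrib, zero_apply] at h3
  rw [fderiv_component_eq_sum_left hr _ _ hy, component_eq_sum_left]
  rw [Finset.sum_congr rfl fun μ _ => mul_comm (component T (e μ) c y) (u μ)] at h3
  linarith

theorem covDeriv_apply (T : TensorField 2) (z a b c : E) :
    covDeriv T z ![a, b, c] = fderiv ℝ (fun y => T (retr y)) z (tanProj z a)
      ![tanProj z b, tanProj z c] := by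
  have h : (fun i => tanProj z (![a, b, c] i)) = ![tanProj z a, tanProj z b, tanProj z c] := by
    ext i : 1; fin_cases i <;> rfl
  simp only [covDeriv, ContinuousMultilinearMap.compContinuousLinearMap_apply, h]
  rfl

/-- The corrections come from the normal parts of `b` and `c`; the normal part of `a` drops out by
homogeneity. Validity on an open set, not only on `dS3`, allows a second differentiation for `box`.
-/
theorem covDeriv_eq (hT : IsRegularSDT T) {z : E} (hz : z ∈ spacelikeRegion) (a b c : E) :
    covDeriv T z ![a, b, c] = fderiv ℝ (component T b c) z a + eta z b * component T a c z
      + eta z c * component T b a z := by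
  have hr := hT.regular
  have ht := hT.tangential
  have hs := hT.symm
  rw [covDeriv_apply, tanProj_apply z b, tanProj_apply z c, bilin_sub_smul]
  simp only [← fderiv_component hr _ _ hz]
  simp only [tanProj_apply, map_sub, map_smul]
  rw [fderiv_component_comm hs b z hz]
  simp only [fderiv_component_self_left hr ht _ hz,
    fderiv_self_of_isHomogZero (contDiffOn_component hr _ _) (isHomogZero_component T _ _) hz,
    component_self_left ht _ hz, component_comm hs a z hz, component_comm hs b a hz]
  simp only [smul_eq_mul]
  ring

/-- The flat and intrinsic divergences differ by `x^μ T_{μw}`, zero by tangentiality, and by `η(x,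
w)` times the trace. -/
theorem divergence_eq (hT : IsRegularSDT T) {x : E} (hx : x ∈ dS3) (w : E) :
    ∑ μ, sgn μ * fderiv ℝ (component T (e μ) w) x (e μ) = 0 := by
  have hx' := dS3_subset_spacelikeRegion hx
  have h := hT.divFree x hx w
  have h2 := hT.traceless x hx
  simp only [divergence, covDeriv_eq hT hx', eta_e] at h
  have h3 : ∀ μ, sgn μ * (fderiv ℝ (component T (e μ) w) x (e μ)
      + sgn μ * x μ * component T (e μ) w x + eta x w * component T (e μ) (e μ) x) =
      sgn μ * fderiv ℝ (component T (e μ) w) x (e μ) + x μ * component T (e μ) w x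
      + eta x w * (sgn μ * T x ![e μ, e μ]) := by
    intro μ
    have := sgn_mul_self μ
    rw [show T x ![e μ, e μ] = component T (e μ) (e μ) x by rw [component, retr_of_mem hx]]
    linear_combination (x μ * component T (e μ) w x) * this
  simp only [h3, Finset.sum_add_distrib, ← component_eq_sum_left,
    component_self_left hT.tangential _ hx', ← Finset.mul_sum] at h
  rw [trace] at h2
  rw [h2] at h
  linarith

/-- First derivatives are homogeneous of degree `-1`, so the identity spreads from `dS3` to an open
set, where it can be differentiated. -/
theorem divergence_eq' (hT : IsRegularSDT T) {y : E} (hy : y ∈ spacelikeRegion) (w : E) :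
    ∑ μ, sgn μ * fderiv ℝ (component T (e μ) w) y (e μ) = 0 := by
  have h : 0 < Real.sqrt (eta y y) := Real.sqrt_pos.2 hy
  have h2 := divergence_eq hT (retr_mem hy) w
  have h3 : ∀ μ, fderiv ℝ (component T (e μ) w) y =
      (Real.sqrt (eta y y))⁻¹ • fderiv ℝ (component T (e μ) w) (retr y) := fun μ =>
    (fderiv_smul_of_isHomogZero (isHomogZero_component T _ _) hy (inv_pos.2 h)).symm
  simp only [h3, smul_apply, smul_eq_mul, mul_left_comm (sgn _), ← Finset.mul_sum, h2, mul_zero]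

theorem differentiableAt_covDeriv (hT : IsRegular T) {z : E} (hz : z ∈ spacelikeRegion) :
    DifferentiableAt ℝ (covDeriv T) z := by
  let Φ : (E →L[ℝ] E [×2]→L[ℝ] ℝ) →L[ℝ] (E [×3]→L[ℝ] ℝ) :=
    ((continuousMultilinearCurryLeftEquiv ℝ (fun _ : Fin 3 => E)
      ℝ).symm.toContinuousLinearEquiv.toContinuousLinearMap)
  have h0 := differentiableAt_of_mem (contDiffOn_fderiv hT) hz
  have h1 : DifferentiableAt ℝ (fun x => Φ (fderiv ℝ (fun y => T (retr y)) x)) z := by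
    clear_value Φ
    fun_prop
  have h2 : ContDiff ℝ ∞ (fun x : E => tanProj x) := by
    refine contDiff_const.sub (ContDiff.smulRight ?_ contDiff_id)
    unfold etaL
    fun_prop
  have h2 : DifferentiableAt ℝ (fun x : E => tanProj x) z := h2.differentiable (by simp) z
  exact (h1.hasFDerivAt.continuousMultilinearMapCompContinuousLinearMap
    fun _ => h2.hasFDerivAt).differentiableAt

theorem fderiv_covDeriv_retr (hT : IsRegular T) {x : E} (hx : x ∈ dS3) (u : E)
    (m : Fin 3 → E) :
    fderiv ℝ (fun y => covDeriv T (retr y)) x u m =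
      fderiv ℝ (fun z => covDeriv T z m) x (tanProj x u) := by
  have h1 := differentiableAt_covDeriv hT (dS3_subset_spacelikeRegion hx)
  have h2 : HasFDerivAt (covDeriv T) (fderiv ℝ (covDeriv T) x) (retr x) := by
    rw [retr_of_mem hx]; exact h1.hasFDerivAt
  have h3 : fderiv ℝ (fun y => covDeriv T (retr y)) x = _ :=
    (h2.comp x (hasFDerivAt_retr hx)).fderiv
  rw [h3, (h1.hasFDerivAt.continuousMultilinear_apply_const m).fderiv]
  rfl

theorem covDeriv_covDeriv_apply (T : TensorField 2) (x d a b c : E) :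
    covDeriv (covDeriv T) x ![d, a, b, c] = fderiv ℝ (fun y => covDeriv T (retr y)) x (tanProj x d)
      ![tanProj x a, tanProj x b, tanProj x c] := by
  have h : (fun i => tanProj x (![d, a, b, c] i)) =
      ![tanProj x d, tanProj x a, tanProj x b, tanProj x c] := by
    ext i : 1; fin_cases i <;> rfl
  rw [covDeriv, ContinuousMultilinearMap.compContinuousLinearMap_apply, h]
  rfl

/-- The factors `η(z, b)` and `η(z, c)` vanish at `x`, so in the correction terms only their own
derivatives survive. -/
theorem fderiv_covDeriv_eq (hT : IsRegularSDT T) {x : E} (hx : x ∈ spacelikeRegion)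
    (d a b c : E) (hb : eta x b = 0) (hc : eta x c = 0) :
    fderiv ℝ (fun z => covDeriv T z ![a, b, c]) x d =
      fderiv ℝ (fderiv ℝ (component T b c)) x d a + eta d b * component T a c x
        + eta d c * component T b a x := by
  have hr := hT.regular
  have hcomp := fun b c => (differentiableAt_of_mem (contDiffOn_component hr b c) hx).hasFDerivAt
  have heta : ∀ b : E, HasFDerivAt (fun z => eta z b) (etaL b) x := fun b => by
    simp_rw [eta_comm _ b]; exact (etaL b).hasFDerivAt
  have h1 : (fun z => covDeriv T z ![a, b, c]) =ᶠ[nhds x]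
      fun z => fderiv ℝ (component T b c) z a + eta z b * component T a c z
        + eta z c * component T b a z := by
    filter_upwards [spacelikeRegion_mem_nhds hx] with z hz
    exact covDeriv_eq hT hz a b c
  have h2 := (((differentiableAt_of_mem (contDiffOn_fderiv_apply
    (contDiffOn_component hr b c) a) hx).hasFDerivAt.add
    ((heta b).mul (hcomp a c))).add ((heta c).mul (hcomp b a)))
  rw [h1.fderiv_eq]
  refine (congrArg (fun L : E →L[ℝ] ℝ => L d) h2.fderiv).trans ?_
  simp only [add_apply, smul_apply, smul_eq_mul, hb, hc, etaL_apply,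
    fderiv_fderiv_apply (contDiffOn_component hr b c) hx, eta_comm _ d]
  ring

theorem sum_sgn_tanProj_mul (L : E →L[ℝ] ℝ) {x b : E} (hx : x ∈ dS3) (hb : eta x b = 0) :
    ∑ μ, sgn μ * (eta (tanProj x (e μ)) b * L (tanProj x (e μ))) = L b := by
  have h := sum_sgn_tanProj ((etaL b).smulRight L) hx
  simp only [ContinuousLinearMap.smulRight_apply, smul_apply, smul_eq_mul, etaL_apply] at h
  rw [eta_comm b x, hb] at h
  simp only [eta_comm _ b, h, eta_e]
  rw [clm_apply_eq_sum L b, zero_mul, sub_zero]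
  refine Finset.sum_congr rfl fun μ _ => ?_
  linear_combination (b μ * L (e μ)) * sgn_mul_self μ

/-- Each of the two correction terms, one per slot, traces to one copy of `T`. -/
theorem box_eq (hT : IsRegularSDT T) {x : E} (hx : x ∈ dS3) (v w : E) :
    box T x v w = dAlembert (component T (tanProj x v) (tanProj x w)) x
      + 2 * component T (tanProj x v) (tanProj x w) x := by
  have hx' := dS3_subset_spacelikeRegion hx
  have hr := hT.regular
  simp only [box, covDeriv_covDeriv_apply, fderiv_covDeriv_retr hr hx, tanProj_tanProj hx,
    fderiv_covDeriv_eq hT hx' _ _ _ _ (eta_tanProj hx v) (eta_tanProj hx w), mul_add,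
    Finset.sum_add_distrib]
  rw [sum_sgn_tanProj_fderiv (contDiffOn_component hr _ _) (isHomogZero_component T _ _) hx,
    two_mul, add_assoc]
  congr 2
  · exact sum_sgn_tanProj_mul (fstForm (T (retr x)) _) hx (eta_tanProj hx v)
  · exact sum_sgn_tanProj_mul (sndForm (T (retr x)) _) hx (eta_tanProj hx w)

theorem fderiv_fderiv_component_eq_sum_left (hT : IsRegular T) (b c : E) {x : E}
    (hx : x ∈ spacelikeRegion) (u v : E) :
    fderiv ℝ (fderiv ℝ (component T b c)) x u v =
      ∑ μ, b μ * fderiv ℝ (fderiv ℝ (component T (e μ) c)) x u v := by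
  have hc := fun b c => contDiffOn_component hT b c
  simp only [← fderiv_fderiv_apply (hc _ _) hx]
  have h1 : (fun y => fderiv ℝ (component T b c) y v) =ᶠ[nhds x]
      fun y => ∑ μ, b μ * fderiv ℝ (component T (e μ) c) y v := by
    filter_upwards [spacelikeRegion_mem_nhds hx] with z hz
    exact fderiv_component_eq_sum_left hT b c hz v
  have h2 : HasFDerivAt (fun y => ∑ μ, b μ * fderiv ℝ (component T (e μ) c) y v)
      (∑ μ, b μ • fderiv ℝ (fun y => fderiv ℝ (component T (e μ) c) y v) x) x :=
    HasFDerivAt.fun_sum fun μ _ =>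
      (differentiableAt_of_mem (contDiffOn_fderiv_apply (hc _ _) v) hx).hasFDerivAt.const_mul _
  rw [h1.fderiv_eq, h2.fderiv]
  simp

theorem dAlembert_component_eq_sum_left (hT : IsRegular T) (b c : E) {x : E}
    (hx : x ∈ spacelikeRegion) :
    dAlembert (component T b c) x = ∑ μ, b μ * dAlembert (component T (e μ) c) x := by
  simp only [dAlembert, Finset.mul_sum]
  rw [Finset.sum_comm]
  refine Finset.sum_congr rfl fun ρ _ => ?_
  rw [fderiv_fderiv_component_eq_sum_left hT b c hx, Finset.mul_sum]
  exact Finset.sum_congr rfl fun μ _ => by ring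

theorem dAlembert_component_comm (hs : ∀ x ∈ dS3, ∀ v w : E, T x ![v, w] = T x ![w, v])
    (b c : E) {x : E} (hx : x ∈ spacelikeRegion) :
    dAlembert (component T b c) x = dAlembert (component T c b) x := by
  have h : fderiv ℝ (component T b c) =ᶠ[nhds x] fderiv ℝ (component T c b) := by
    filter_upwards [spacelikeRegion_mem_nhds hx] with z hz
    exact fderiv_component_comm hs b c hz
  simp only [dAlembert, h.fderiv_eq]

/-- Differentiating `z^μ T_{μc}(z) = 0` twice and tracing leaves `-2 ∂^μ T_{μc}`, which is zero.
Hence the projections in `box_eq` can be dropped. -/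
theorem dAlembert_component_self_left (hT : IsRegularSDT T) (c : E) {x : E} (hx : x ∈ dS3) :
    dAlembert (component T x c) x = 0 := by
  have hx' := dS3_subset_spacelikeRegion hx
  have hr := hT.regular
  have hc := fun b c => contDiffOn_component hr b c
  have key : ∀ u : E, ∑ μ, x μ * fderiv ℝ (fderiv ℝ (component T (e μ) c)) x u u
      = -2 * fderiv ℝ (component T u c) x u := by
    intro u
    have h1 : (fun z => ∑ μ, z μ * fderiv ℝ (component T (e μ) c) z u) =ᶠ[nhds x]
        fun z => -component T u c z := by
      filter_upwards [spacelikeRegion_mem_nhds hx'] with z hz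
      rw [← fderiv_component_eq_sum_left hr _ _ hz,
        fderiv_component_self_left hr hT.tangential c hz]
    have h2 : HasFDerivAt (fun z : E => ∑ μ, z μ * fderiv ℝ (component T (e μ) c) z u)
        (∑ μ, (x μ • fderiv ℝ (fun z => fderiv ℝ (component T (e μ) c) z u) x
          + fderiv ℝ (component T (e μ) c) x u • (ContinuousLinearMap.proj μ : E →L[ℝ] ℝ))) x :=
      HasFDerivAt.fun_sum fun μ _ => (hasFDerivAt_apply μ x).mul
        (differentiableAt_of_mem (contDiffOn_fderiv_apply (hc _ _) u) hx').hasFDerivAt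
    have h3 : HasFDerivAt (fun z => -component T u c z) (-fderiv ℝ (component T u c) x) x :=
      (differentiableAt_of_mem (hc _ _) hx').hasFDerivAt.neg
    have h4 := congrArg (fun L : E →L[ℝ] ℝ => L u) (h2.unique (h3.congr_of_eventuallyEq h1))
    simp only [sum_apply, add_apply, smul_apply, smul_eq_mul, neg_apply,
      ContinuousLinearMap.proj_apply, Finset.sum_add_distrib,
      fderiv_fderiv_apply (hc _ _) hx'] at h4
    rw [Finset.sum_congr rfl fun μ _ => mul_comm (fderiv ℝ (component T (e μ) c) x u) (u μ),
      ← fderiv_component_eq_sum_left hr _ _ hx'] at h4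
    linarith
  simp only [dAlembert, fderiv_fderiv_component_eq_sum_left hr x c hx', key]
  simp only [mul_left_comm (sgn _) (-2), ← Finset.mul_sum, divergence_eq hT hx c, mul_zero]

theorem dAlembert_component_sub_smul (hT : IsRegularSDT T) (r : ℝ) (b c : E) {x : E}
    (hx : x ∈ dS3) :
    dAlembert (component T (b - r • x) c) x = dAlembert (component T b c) x := by
  have hx' := dS3_subset_spacelikeRegion hx
  have h := dAlembert_component_self_left hT c hx
  rw [dAlembert_component_eq_sum_left hT.regular _ _ hx'] at h ⊢
  rw [dAlembert_component_eq_sum_left hT.regular b c hx']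
  simp only [Pi.sub_apply, Pi.smul_apply, smul_eq_mul, sub_mul, Finset.sum_sub_distrib, mul_assoc,
    ← Finset.mul_sum, h]
  ring

theorem component_sub_smul (ht : IsTangential T) (r : ℝ) (b c : E) {x : E}
    (hx : x ∈ spacelikeRegion) : component T (b - r • x) c x = component T b c x := by
  have h := component_self_left ht c hx
  rw [component_eq_sum_left] at h ⊢
  rw [component_eq_sum_left T b]
  simp only [Pi.sub_apply, Pi.smul_apply, smul_eq_mul, sub_mul, Finset.sum_sub_distrib, mul_assoc,
    ← Finset.mul_sum, h]
  ring

/-- The wave equation on the hyperboloid in terms of the flat d'Alembertian. -/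
theorem dAlembert_component_of_box (hT : IsRegularSDT T) {x : E} (hx : x ∈ dS3) (m : ℝ)
    (hbox : ∀ v w : E, box T x v w + m * T x ![v, w] = 0) (b c : E) :
    dAlembert (component T b c) x = -(m + 2) * component T b c x := by
  have hx' := dS3_subset_spacelikeRegion hx
  have h := hbox b c
  have hs := hT.symm
  rw [box_eq hT hx, tanProj_apply, tanProj_apply, dAlembert_component_sub_smul hT _ _ _ hx,
    dAlembert_component_comm hs _ _ hx', dAlembert_component_sub_smul hT _ _ _ hx,
    dAlembert_component_comm hs _ _ hx', component_sub_smul hT.tangential _ _ _ hx',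
    component_comm hs _ _ hx', component_sub_smul hT.tangential _ _ _ hx',
    component_comm hs _ _ hx'] at h
  rw [show T x ![b, c] = component T b c x by rw [component, retr_of_mem hx]] at h
  linarith

end Regular

/-! ### Coordinates and the parametrized Cauchy surface. -/

theorem coordPt_mem (τ θ φ : ℝ) : coordPt τ θ φ ∈ dS3 := by
  change eta _ _ = 1
  rw [eta_apply]
  simp only [coordPt, spherePt, Matrix.cons_val]
  have h1 := Real.cosh_sq τ
  have h2 := Real.sin_sq_add_cos_sq θ
  have h3 := Real.sin_sq_add_cos_sq φ
  linear_combination (Real.cosh τ ^ 2 * Real.sin θ ^ 2) * h3 + Real.cosh τ ^ 2 * h2 + h1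

theorem timeCoord_coordPt (τ θ φ : ℝ) : timeCoord (coordPt τ θ φ) = τ := by
  simp [timeCoord, coordPt]

theorem sphereCoord_coordPt (τ θ φ : ℝ) : sphereCoord (coordPt τ θ φ) = spherePt θ φ := by
  have h := (Real.cosh_pos τ).ne'
  ext i
  rw [sphereCoord, timeCoord_coordPt]
  fin_cases i <;> simp [coordPt] <;> field_simp

theorem height_coordPt (F : (Fin 3 → ℝ) → ℝ) (τ θ φ : ℝ) :
    height F (coordPt τ θ φ) = τ - F (spherePt θ φ) := by
  rw [height, timeCoord_coordPt, sphereCoord_coordPt]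

theorem contDiff_height {F : (Fin 3 → ℝ) → ℝ} (hF : ContDiff ℝ ∞ F) :
    ContDiff ℝ ∞ (height F) := by
  have h1 : ContDiff ℝ ∞ timeCoord := Real.contDiff_arsinh.comp (contDiff_apply ℝ ℝ 0)
  refine h1.sub (hF.comp (contDiff_pi.2 fun i => ?_))
  refine ContDiff.mul (ContDiff.inv (Real.contDiff_cosh.comp h1) fun x => ?_)
    (contDiff_apply ℝ ℝ i.succ)
  exact (Real.cosh_pos _).ne'

namespace CauchySurface

variable (S : CauchySurface)

theorem pt_mem (θ φ : ℝ) : S.pt θ φ ∈ dS3 := coordPt_mem _ _ _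

/-- The parametrization of the Cauchy surface as a map of the plane. -/
noncomputable def param (q : ℝ × ℝ) : E := S.pt q.1 q.2

theorem param_mem (q : ℝ × ℝ) : S.param q ∈ dS3 := coordPt_mem _ _ _

theorem contDiff_param : ContDiff ℝ ∞ S.param := by
  have h1 : ContDiff ℝ ∞ (fun q : ℝ × ℝ => spherePt q.1 q.2) := by
    refine contDiff_pi.2 fun i => ?_
    fin_cases i <;> simp [spherePt] <;> fun_prop
  have h2 := S.smooth.comp h1
  refine contDiff_pi.2 fun i => ?_
  have h3 := fun i => contDiff_pi.1 h1 i
  fin_cases i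
  · exact Real.contDiff_sinh.comp h2
  · exact (Real.contDiff_cosh.comp h2).mul (h3 0)
  · exact (Real.contDiff_cosh.comp h2).mul (h3 1)
  · exact (Real.contDiff_cosh.comp h2).mul (h3 2)

theorem differentiable_param : Differentiable ℝ S.param := S.contDiff_param.differentiable (by simp)

theorem hasDerivAt_pt_polar (θ φ : ℝ) :
    HasDerivAt (fun t => S.pt t φ) (fderiv ℝ S.param (θ, φ) (1, 0)) θ :=
  (S.differentiable_param (θ, φ)).hasFDerivAt.comp_hasDerivAt (f := fun t => (t, φ)) θ
    ((hasDerivAt_id θ).prodMk (hasDerivAt_const θ φ))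

theorem hasDerivAt_pt_azimuth (θ φ : ℝ) :
    HasDerivAt (fun t => S.pt θ t) (fderiv ℝ S.param (θ, φ) (0, 1)) φ :=
  (S.differentiable_param (θ, φ)).hasFDerivAt.comp_hasDerivAt (f := fun t => (θ, t)) φ
    ((hasDerivAt_const φ θ).prodMk (hasDerivAt_id φ))

theorem eta_fderiv_param (q v : ℝ × ℝ) : eta (S.param q) (fderiv ℝ S.param q v) = 0 := by
  have h1 := (hasFDerivAt_eta_self (S.param q)).comp q (S.differentiable_param q).hasFDerivAt
  have h2 : HasFDerivAt ((fun y => eta y y) ∘ S.param) (0 : ℝ × ℝ →L[ℝ] ℝ) q :=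
    (hasFDerivAt_const (1 : ℝ) q).congr_of_eventuallyEq
      (Filter.Eventually.of_forall fun z => S.param_mem z)
  have h3 := congrArg (fun L : ℝ × ℝ →L[ℝ] ℝ => L v) (h1.unique h2)
  simp [etaL_apply] at h3
  exact h3

theorem spherePt_of_sin_eq_zero {θ : ℝ} (h : Real.sin θ = 0) (φ φ' : ℝ) :
    spherePt θ φ = spherePt θ φ' := by
  simp [spherePt, h]

theorem fderiv_param_azimuth_of_sin_eq_zero {θ : ℝ} (h : Real.sin θ = 0) (φ : ℝ) :
    fderiv ℝ S.param (θ, φ) (0, 1) = 0 := by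
  refine (S.hasDerivAt_pt_azimuth θ φ).unique ?_
  have : (fun t => S.pt θ t) = fun _ => S.pt θ 0 := by
    funext t
    simp only [pt, coordPt, spherePt_of_sin_eq_zero h t 0]
  rw [this]
  exact hasDerivAt_const _ _

theorem pt_two_pi (θ : ℝ) : S.pt θ (2 * Real.pi) = S.pt θ 0 := by
  simp [pt, coordPt, spherePt]

theorem fderiv_param_polar_two_pi (θ : ℝ) :
    fderiv ℝ S.param (θ, 2 * Real.pi) (1, 0) = fderiv ℝ S.param (θ, 0) (1, 0) := by
  refine (S.hasDerivAt_pt_polar θ (2 * Real.pi)).unique ?_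
  simp only [pt_two_pi]
  exact S.hasDerivAt_pt_polar θ 0

/-! ### Stokes' theorem on the surface. -/

/-- Stokes' theorem for an exact two-form on a Cauchy surface. -/
theorem integral_exterior_deriv_eq_zero {W : E → E →L[ℝ] ℝ}
    (hW : ContDiffOn ℝ ∞ W spacelikeRegion) :
    ∫ θ in (0 : ℝ)..Real.pi, ∫ φ in (0 : ℝ)..(2 * Real.pi),
      (fderiv ℝ W (S.param (θ, φ)) (fderiv ℝ S.param (θ, φ) (1, 0)) (fderiv ℝ S.param (θ, φ) (0, 1))
      - fderiv ℝ W (S.param (θ, φ)) (fderiv ℝ S.param (θ, φ) (0, 1))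
        (fderiv ℝ S.param (θ, φ) (1, 0))) = 0 := by
  have hmem : ∀ q, S.param q ∈ spacelikeRegion := fun q =>
    dS3_subset_spacelikeRegion (S.param_mem q)
  have hWp : ContDiff ℝ ∞ (fun q => W (S.param q)) := by
    rw [← contDiffOn_univ]
    exact hW.comp S.contDiff_param.contDiffOn fun q _ => hmem q
  have hdp : ContDiff ℝ ∞ (fderiv ℝ S.param) := S.contDiff_param.fderiv_right (by simp)
  have hF : ∀ v : ℝ × ℝ, ContDiff ℝ ∞ (fun q => W (S.param q) (fderiv ℝ S.param q v)) := fun v =>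
    hWp.clm_apply (hdp.clm_apply contDiff_const)
  have hFd : ∀ v u q, fderiv ℝ (fun q => W (S.param q) (fderiv ℝ S.param q v)) q u =
      fderiv ℝ W (S.param q) (fderiv ℝ S.param q u) (fderiv ℝ S.param q v)
        + W (S.param q) (fderiv ℝ (fderiv ℝ S.param) q u v) := by
    intro v u q
    have h1 : HasFDerivAt (fun q => W (S.param q)) _ q :=
      (differentiableAt_of_mem hW (hmem q)).hasFDerivAt.comp q
        (S.differentiable_param q).hasFDerivAt
    have h2 := ((hdp.differentiable (by simp)) q).hasFDerivAt.clm_apply (hasFDerivAt_const v q)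
    rw [(h1.clm_apply h2).fderiv]
    simp
    ring
  have hsymm : ∀ q u v, fderiv ℝ (fderiv ℝ S.param) q u v = fderiv ℝ (fderiv ℝ S.param) q v u :=
    fun q u v => (S.contDiff_param.contDiffAt.isSymmSndFDerivAt (by simp [two_le_infty])).eq u v
  have hf := hF (0, 1)
  have hg := (hF (1, 0)).neg
  -- The plane field `(W(X_φ), -W(X_θ))` has the pullback of `dW` as its divergence.
  have key := MeasureTheory.integral2_divergence_prod_of_hasFDerivAt
    (fun q => W (S.param q) (fderiv ℝ S.param q (0, 1)))
    (fun q => -W (S.param q) (fderiv ℝ S.param q (1, 0)))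
    (fderiv ℝ (fun q => W (S.param q) (fderiv ℝ S.param q (0, 1))))
    (fderiv ℝ (fun q => -W (S.param q) (fderiv ℝ S.param q (1, 0))))
    0 0 Real.pi (2 * Real.pi) hf.continuous.continuousOn hg.continuous.continuousOn
    (fun q _ => (hf.differentiable (by simp) q).hasFDerivAt)
    (fun q _ => (hg.differentiable (by simp) q).hasFDerivAt)
    (by
      refine ContinuousOn.integrableOn_compact
        (isCompact_uIcc.prod isCompact_uIcc) (Continuous.continuousOn ?_)
      exact ((hf.continuous_fderiv (by simp)).clm_apply continuous_const).add
        ((hg.continuous_fderiv (by simp)).clm_apply continuous_const))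
  have hpole : ∀ θ, Real.sin θ = 0 → ∀ φ, fderiv ℝ S.param (θ, φ) (0, 1) = 0 := fun θ h φ =>
    S.fderiv_param_azimuth_of_sin_eq_zero h φ
  -- The edges `θ = 0` and `θ = π` contribute nothing because `X_φ` vanishes at the poles; the edges
  -- `φ = 0` and `φ = 2π` cancel by periodicity.
  simp only [fderiv_fun_neg, neg_apply, hFd, fderiv_param_polar_two_pi,
    hpole _ Real.sin_zero, hpole _ Real.sin_pi, map_zero, intervalIntegral.integral_zero] at key
  rw [show (fun θ => -(W (S.param (θ, 2 * Real.pi))) (fderiv ℝ S.param (θ, 0) (1, 0))) =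
    fun θ => -(W (S.param (θ, 0))) (fderiv ℝ S.param (θ, 0) (1, 0)) by
      funext θ; simp only [param, pt_two_pi]] at key
  rw [sub_self, add_zero, sub_zero] at key
  refine Eq.trans ?_ key
  refine intervalIntegral.integral_congr fun θ _ => intervalIntegral.integral_congr fun φ _ => ?_
  simp only [hsymm _ (1, 0) (0, 1)]
  ring

/-! ### The unit normal and the area element. -/

/-- The coordinate vector `∂_τ` along the surface. -/
noncomputable def timeVec (θ φ : ℝ) : E :=
  ![Real.cosh (S.F (spherePt θ φ)), Real.sinh (S.F (spherePt θ φ)) * spherePt θ φ 0,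
    Real.sinh (S.F (spherePt θ φ)) * spherePt θ φ 1,
    Real.sinh (S.F (spherePt θ φ)) * spherePt θ φ 2]

theorem hasDerivAt_coordPt_time (τ θ φ : ℝ) :
    HasDerivAt (fun s => coordPt s θ φ) (![Real.cosh τ, Real.sinh τ * spherePt θ φ 0,
      Real.sinh τ * spherePt θ φ 1, Real.sinh τ * spherePt θ φ 2] : E) τ := by
  refine hasDerivAt_pi.2 fun i => ?_
  fin_cases i
  · exact Real.hasDerivAt_sinh τ
  · exact (Real.hasDerivAt_cosh τ).mul_const _
  · exact (Real.hasDerivAt_cosh τ).mul_const _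
  · exact (Real.hasDerivAt_cosh τ).mul_const _

theorem eta_timeVec (θ φ : ℝ) : eta (S.pt θ φ) (S.timeVec θ φ) = 0 := by
  rw [eta_apply]
  simp only [pt, coordPt, timeVec]
  generalize S.F (spherePt θ φ) = τ
  simp only [spherePt, Matrix.cons_val]
  have h2 := Real.sin_sq_add_cos_sq θ
  have h3 := Real.sin_sq_add_cos_sq φ
  linear_combination (Real.cosh τ * Real.sinh τ) * (h2 + Real.sin θ ^ 2 * h3)

theorem exists_fderiv_param_polar (θ φ : ℝ) : ∃ a : ℝ, fderiv ℝ S.param (θ, φ) (1, 0) =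
    a • S.timeVec θ φ + Real.cosh (S.F (spherePt θ φ)) •
      (![0, -Real.sin θ, Real.cos θ * Real.cos φ, Real.cos θ * Real.sin φ] : E) := by
  have h1 : Differentiable ℝ (fun t => spherePt t φ) := by
    refine differentiable_pi.2 fun i => ?_
    fin_cases i <;> simp [spherePt]
  have h2 := (((S.smooth.differentiable (by simp)).comp h1) θ).hasDerivAt
  set a := deriv (S.F ∘ fun t => spherePt t φ) θ
  refine ⟨a, (S.hasDerivAt_pt_polar θ φ).unique (hasDerivAt_pi.2 fun i => ?_)⟩
  fin_cases i
  · refine h2.sinh.congr_deriv ?_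
    simp [timeVec]; ring
  · refine (h2.cosh.mul (Real.hasDerivAt_cos θ)).congr_deriv ?_
    simp [timeVec, spherePt]; ring
  · refine (h2.cosh.mul ((Real.hasDerivAt_sin θ).mul_const (Real.cos φ))).congr_deriv ?_
    simp [timeVec, spherePt]; ring
  · refine (h2.cosh.mul ((Real.hasDerivAt_sin θ).mul_const (Real.sin φ))).congr_deriv ?_
    simp [timeVec, spherePt]; ring

theorem exists_fderiv_param_azimuth (θ φ : ℝ) : ∃ a : ℝ, fderiv ℝ S.param (θ, φ) (0, 1) =
    a • S.timeVec θ φ + Real.cosh (S.F (spherePt θ φ)) •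
      (![0, 0, -(Real.sin θ * Real.sin φ), Real.sin θ * Real.cos φ] : E) := by
  have h1 : Differentiable ℝ (fun t => spherePt θ t) := by
    refine differentiable_pi.2 fun i => ?_
    fin_cases i <;> simp [spherePt]
  have h2 := (((S.smooth.differentiable (by simp)).comp h1) φ).hasDerivAt
  set a := deriv (S.F ∘ fun t => spherePt θ t) φ
  refine ⟨a, (S.hasDerivAt_pt_azimuth θ φ).unique (hasDerivAt_pi.2 fun i => ?_)⟩
  fin_cases i
  · refine h2.sinh.congr_deriv ?_
    simp [timeVec]; ring
  · refine (h2.cosh.mul_const (Real.cos θ)).congr_deriv ?_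
    simp [timeVec, spherePt]; ring
  · refine (h2.cosh.mul ((Real.hasDerivAt_cos φ).const_mul (Real.sin θ))).congr_deriv ?_
    simp [timeVec, spherePt]; ring
  · refine (h2.cosh.mul ((Real.hasDerivAt_sin φ).const_mul (Real.sin θ))).congr_deriv ?_
    simp [timeVec, spherePt]; ring

/-- The derivatives of `F` enter only through multiples of `∂_τ`, which drop out of the determinant;
what remains is the volume density of `dS3`. -/
theorem vol_timeVec (θ φ : ℝ) :
    vol (S.pt θ φ) (S.timeVec θ φ) (fderiv ℝ S.param (θ, φ) (1, 0))
      (fderiv ℝ S.param (θ, φ) (0, 1)) = -(Real.cosh (S.F (spherePt θ φ)) ^ 2 * Real.sin θ) := by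
  obtain ⟨a, ha⟩ := S.exists_fderiv_param_polar θ φ
  obtain ⟨b, hb⟩ := S.exists_fderiv_param_azimuth θ φ
  have hred : ∀ p t u v : E, vol p t (a • t + u) (b • t + v) = vol p t u v := by
    intro p t u v
    simp only [vol_apply, Pi.add_apply, Pi.smul_apply, smul_eq_mul]; ring
  rw [ha, hb, hred]
  simp only [pt, timeVec]
  generalize S.F (spherePt θ φ) = τ
  simp only [vol_apply, coordPt, spherePt, Matrix.cons_val, Pi.smul_apply, smul_eq_mul]
  have h1 := Real.cosh_sq τ
  have h2 := Real.sin_sq_add_cos_sq θ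
  have h3 := Real.sin_sq_add_cos_sq φ
  linear_combination (-Real.cosh τ ^ 2 * Real.sin θ) * h1
    - Real.cosh τ ^ 2 * Real.sin θ * (Real.cosh τ ^ 2 - Real.sinh τ ^ 2) *
      ((Real.sin φ ^ 2 + Real.cos φ ^ 2) * h2 + h3)

theorem hasFDerivAt_height (q : ℝ × ℝ) :
    HasFDerivAt (fun y => height S.F (retr y))
      (fderiv ℝ (fun y => height S.F (retr y)) (S.param q)) (S.param q) :=
  (((contDiff_height S.smooth).contDiffAt.comp _ (contDiffAt_retr
    (dS3_subset_spacelikeRegion (S.param_mem q)))).differentiableAt (by simp)).hasFDerivAt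

theorem fderiv_height_fderiv_param (q v : ℝ × ℝ) :
    fderiv ℝ (fun y => height S.F (retr y)) (S.param q) (fderiv ℝ S.param q v) = 0 := by
  have h1 := (S.hasFDerivAt_height q).comp q (S.differentiable_param q).hasFDerivAt
  have h2 : HasFDerivAt ((fun y => height S.F (retr y)) ∘ S.param) (0 : ℝ × ℝ →L[ℝ] ℝ) q := by
    refine (hasFDerivAt_const (0 : ℝ) q).congr_of_eventuallyEq
      (Filter.Eventually.of_forall fun z => ?_)
    change height S.F (retr (S.param z)) = 0
    rw [retr_of_mem (S.param_mem z), param, pt, height_coordPt, sub_self]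
  exact congrArg (fun L : ℝ × ℝ →L[ℝ] ℝ => L v) (h1.unique h2)

theorem fderiv_height_timeVec (θ φ : ℝ) :
    fderiv ℝ (fun y => height S.F (retr y)) (S.pt θ φ) (S.timeVec θ φ) = 1 := by
  have h1 := (S.hasFDerivAt_height (θ, φ)).comp_hasDerivAt (S.F (spherePt θ φ))
    (hasDerivAt_coordPt_time (S.F (spherePt θ φ)) θ φ)
  refine h1.unique ?_
  have : ((fun y => height S.F (retr y)) ∘ fun s => coordPt s θ φ) =
      fun s => s - S.F (spherePt θ φ) := by
    funext s
    simp only [Function.comp, retr_of_mem (coordPt_mem _ _ _), height_coordPt]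
  rw [this]
  exact (hasDerivAt_id _).sub_const _

/-- Off the poles, `x`, `∂_τ`, `X_θ`, `X_φ` form a basis, and both linear forms in `v` agree on it.
At the poles both sides vanish. -/
theorem smul_fderiv_height (θ φ : ℝ) (v : E) :
    (Real.cosh (S.F (spherePt θ φ)) ^ 2 * Real.sin θ) *
      fderiv ℝ (fun y => height S.F (retr y)) (S.pt θ φ) (tanProj (S.pt θ φ) v) =
    -vol (S.pt θ φ) v (fderiv ℝ S.param (θ, φ) (1, 0)) (fderiv ℝ S.param (θ, φ) (0, 1)) := by
  set κ := Real.cosh (S.F (spherePt θ φ)) ^ 2 * Real.sin θ with hκ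
  by_cases h : Real.sin θ = 0
  · rw [hκ, h, S.fderiv_param_azimuth_of_sin_eq_zero h]
    simp [vol_apply]
  set x := S.pt θ φ with hx
  set t := S.timeVec θ φ with ht
  set u := fderiv ℝ S.param (θ, φ) (1, 0) with hu
  set w := fderiv ℝ S.param (θ, φ) (0, 1) with hw
  have hκ0 : κ ≠ 0 := mul_ne_zero (pow_ne_zero _ (Real.cosh_pos _).ne') h
  let L : E →L[ℝ] ℝ := κ • (fderiv ℝ (fun y => height S.F (retr y)) x).comp (tanProj x)
    - volFst x u w
  have hL : ∀ z, L z = κ * fderiv ℝ (fun y => height S.F (retr y)) x (tanProj x z)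
      - vol z x u w := fun z => rfl
  have hvol : vol x t u w = -κ := S.vol_timeVec θ φ
  have e1 : L x = 0 := by
    rw [hL, tanProj_self (S.pt_mem θ φ), map_zero]
    simp only [vol_apply]; ring
  have e2 : L t = 0 := by
    rw [hL, tanProj_of_tangent (S.eta_timeVec θ φ), S.fderiv_height_timeVec, vol_swap_fst, hvol]
    ring
  have e3 : ∀ v, L (fderiv ℝ S.param (θ, φ) v) =
      -vol (fderiv ℝ S.param (θ, φ) v) x u w := fun v => by
    have : eta x (fderiv ℝ S.param (θ, φ) v) = 0 := S.eta_fderiv_param (θ, φ) v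
    have h0 : fderiv ℝ (fun y => height S.F (retr y)) x (fderiv ℝ S.param (θ, φ) v) = 0 :=
      S.fderiv_height_fderiv_param (θ, φ) v
    rw [hL, tanProj_of_tangent this, h0]; ring
  have e4 : L u = 0 := by
    rw [hu, e3]; simp only [vol_apply]; ring
  have e5 : L w = 0 := by
    rw [hw, e3]; simp only [vol_apply]; ring
  have h5 := clm_mul_vol L v x t u w
  rw [e1, e2, e4, e5, hvol] at h5
  have h6 : L v = 0 := by
    have : L v * κ = 0 := by linarith
    exact (mul_eq_zero.1 this).resolve_right hκ0
  rw [hL, vol_swap_fst x v] at h6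
  linarith

/-- The gradient of the height is proportional to the cross product of `X_θ` and `X_φ`. By the Gram
identity the area density contains the norm of this gradient, which cancels the normalization of the
normal. -/
theorem normal_mul_areaDensity {θ : ℝ} (hθ : 0 ≤ Real.sin θ) (φ : ℝ) (μ : Fin 4) :
    S.normal (S.pt θ φ) μ * S.areaDensity θ φ = sgn μ * vol (S.pt θ φ) (e μ)
      (fderiv ℝ S.param (θ, φ) (1, 0)) (fderiv ℝ S.param (θ, φ) (0, 1)) := by
  have hg := S.smul_fderiv_height θ φ
  have hsl := S.spacelike _ (S.pt_mem θ φ) (by rw [pt, height_coordPt, sub_self])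
  have hgram := sum_sgn_mul_vol_sq (S.pt θ φ) _ _ (S.pt_mem θ φ)
    (S.eta_fderiv_param (θ, φ) (1, 0)) (S.eta_fderiv_param (θ, φ) (0, 1))
  have hκ0 : 0 ≤ Real.cosh (S.F (spherePt θ φ)) ^ 2 * Real.sin θ := by positivity
  simp only [areaDensity, normal, (S.hasDerivAt_pt_polar θ φ).deriv,
    (S.hasDerivAt_pt_azimuth θ φ).deriv]
  set κ := Real.cosh (S.F (spherePt θ φ)) ^ 2 * Real.sin θ
  set x := S.pt θ φ with hx
  set u := fderiv ℝ S.param (θ, φ) (1, 0) with hu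
  set w := fderiv ℝ S.param (θ, φ) (0, 1) with hw
  set G := grad (height S.F) x with hG
  have hGμ : ∀ μ, κ * G μ = -(sgn μ * vol x (e μ) u w) := by
    intro μ
    have : G μ = sgn μ * fderiv ℝ (fun y => height S.F (retr y)) x (tanProj x (e μ)) := rfl
    rw [this]
    linear_combination sgn μ * hg (e μ)
  have hGG : κ ^ 2 * eta G G = ∑ μ, sgn μ * vol x (e μ) u w ^ 2 := by
    have : eta G G = ∑ μ, sgn μ * G μ ^ 2 := by
      rw [eta_apply]; simp [Fin.sum_univ_four, sgn]; ring
    rw [this, Finset.mul_sum]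
    refine Finset.sum_congr rfl fun μ _ => ?_
    have h2 := hGμ μ
    have h3 := sgn_mul_self μ
    linear_combination (sgn μ * (κ * G μ - sgn μ * vol x (e μ) u w)) * h2
      + (sgn μ * vol x (e μ) u w ^ 2) * h3
  have hdet : eta u u * eta w w - eta u w ^ 2 = κ ^ 2 * -eta G G := by
    linarith
  -- Here the surface must be spacelike: its normal has nonzero length.
  have hs : Real.sqrt (-eta G G) ≠ 0 := (Real.sqrt_pos.2 (by linarith)).ne'
  rw [hdet, Real.sqrt_mul (by positivity), Real.sqrt_sq hκ0]
  simp only [Pi.neg_apply, Pi.smul_apply, smul_eq_mul]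
  field_simp
  linarith [hGμ μ]

end CauchySurface

theorem charge_eq_integral_vol (T : TensorField 2) (ξ : E → E) (S : CauchySurface) :
    charge T ξ S = ∫ θ in (0 : ℝ)..Real.pi, ∫ φ in (0 : ℝ)..(2 * Real.pi),
      ∑ μ, sgn μ * T (S.pt θ φ) ![ξ (S.pt θ φ), e μ] * vol (S.pt θ φ) (e μ)
        (fderiv ℝ S.param (θ, φ) (1, 0)) (fderiv ℝ S.param (θ, φ) (0, 1)) := by
  refine intervalIntegral.integral_congr fun θ hθ => ?_
  rw [Set.uIcc_of_le Real.pi_pos.le] at hθ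
  have hs := Real.sin_nonneg_of_mem_Icc hθ
  refine intervalIntegral.integral_congr fun φ _ => ?_
  rw [bilin_eq_sum_right, Finset.sum_mul]
  refine Finset.sum_congr rfl fun μ _ => ?_
  linear_combination T (S.pt θ φ) ![ξ (S.pt θ φ), e μ] * S.normal_mul_areaDensity hs φ μ

/-! ### The superpotential and its contractions. -/

/-- The vector field `y ↦ b + M y` of the ambient space. -/
noncomputable def affineField (b : E) (M : Fin 4 → Fin 4 → ℝ) (y : E) : E :=
  fun μ => b μ + ∑ ν, M μ ν * y ν

/-- The superpotential `ξ^μ ∂_ρ T_{μν} - (∂_ρ ξ^μ) T_{μν}` for `ξ = b + M y`. -/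
noncomputable def superpotential (T : TensorField 2) (b : E) (M : Fin 4 → Fin 4 → ℝ)
    (ρ ν : Fin 4) (y : E) : ℝ :=
  ∑ μ, (affineField b M y μ * fderiv ℝ (component T (e μ) (e ν)) y (e ρ)
    - M μ ρ * component T (e μ) (e ν) y)

/-- The derivative of `superpotential`. -/
noncomputable def superpotentialDeriv (T : TensorField 2) (b : E) (M : Fin 4 → Fin 4 → ℝ)
    (ρ ν : Fin 4) (x : E) : E →L[ℝ] ℝ :=
  ∑ μ, (affineField b M x μ • fderiv ℝ (fun y => fderiv ℝ (component T (e μ) (e ν)) y (e ρ)) x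
    + fderiv ℝ (component T (e μ) (e ν)) x (e ρ) •
        (∑ σ, M μ σ • (ContinuousLinearMap.proj σ : E →L[ℝ] ℝ))
    - M μ ρ • fderiv ℝ (component T (e μ) (e ν)) x)

section

variable {T : TensorField 2} (b : E) (M : Fin 4 → Fin 4 → ℝ)

theorem hasFDerivAt_superpotential (hT : IsRegular T) (ρ ν : Fin 4) {x : E}
    (hx : x ∈ spacelikeRegion) :
    HasFDerivAt (superpotential T b M ρ ν) (superpotentialDeriv T b M ρ ν x) x := by
  have hc := fun b c => contDiffOn_component hT b c
  refine HasFDerivAt.fun_sum fun μ _ => HasFDerivAt.sub (HasFDerivAt.mul ?_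
    (differentiableAt_of_mem (contDiffOn_fderiv_apply (hc _ _) _) hx).hasFDerivAt)
    ((differentiableAt_of_mem (hc _ _) hx).hasFDerivAt.const_mul _)
  exact (HasFDerivAt.fun_sum fun σ _ => (hasFDerivAt_apply σ x).const_mul (M μ σ)).const_add (b μ)

theorem contDiffOn_superpotential (hT : IsRegular T) (ρ ν : Fin 4) :
    ContDiffOn ℝ ∞ (superpotential T b M ρ ν) spacelikeRegion := by
  have hc := fun b c => contDiffOn_component hT b c
  refine ContDiffOn.sum fun μ _ => ContDiffOn.sub (ContDiffOn.mul (ContDiff.contDiffOn ?_)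
    (contDiffOn_fderiv_apply (hc _ _) _)) (contDiffOn_const.mul (hc _ _))
  unfold affineField
  fun_prop

theorem superpotentialDeriv_apply (hT : IsRegular T) (ρ ν : Fin 4) {x : E}
    (hx : x ∈ spacelikeRegion) (u : E) :
    superpotentialDeriv T b M ρ ν x u = ∑ μ, (affineField b M x μ *
        fderiv ℝ (fderiv ℝ (component T (e μ) (e ν))) x u (e ρ)
      + fderiv ℝ (component T (e μ) (e ν)) x (e ρ) * (∑ σ, M μ σ * u σ)
      - M μ ρ * fderiv ℝ (component T (e μ) (e ν)) x u) := by
  simp [superpotentialDeriv, fderiv_fderiv_apply (contDiffOn_component hT _ _) hx]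

theorem sum_mul_e (f : Fin 4 → ℝ) (ρ : Fin 4) : ∑ σ, f σ * e ρ σ = f ρ := by
  simp [e, Pi.single_apply]

variable {b M} {α : ℝ}

/-- Euler's relation in degree `α - 1`. Apart from the zero field, `hα` and `hM` leave constant
fields (`α = 0`, `M = 0`) and linear fields (`α = 1`, `b = 0`). -/
theorem superpotentialDeriv_self (hT : IsRegular T)
    (hα : ∀ x μ, ∑ ν, M μ ν * x ν = α * affineField b M x μ)
    (hM : ∀ μ ν, (α - 1) * M μ ν = 0) (ρ ν : Fin 4) {x : E} (hx : x ∈ spacelikeRegion) :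
    superpotentialDeriv T b M ρ ν x x = (α - 1) * superpotential T b M ρ ν x := by
  have hc := fun b c => contDiffOn_component hT b c
  rw [superpotentialDeriv_apply b M hT ρ ν hx, superpotential, Finset.mul_sum]
  refine Finset.sum_congr rfl fun μ _ => ?_
  rw [fderiv_fderiv_comm (hc _ _) hx,
    fderiv_fderiv_self_of_isHomogZero (hc _ _) (isHomogZero_component T _ _) hx,
    fderiv_self_of_isHomogZero (hc _ _) (isHomogZero_component T _ _) hx, hα]
  linear_combination component T (e μ) (e ν) x * hM μ ρ

/-- The radial derivative of `T` vanishes and that of the field is `α` times the field. -/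
theorem sum_mul_superpotential_left (hT : IsRegular T)
    (hα : ∀ x μ, ∑ ν, M μ ν * x ν = α * affineField b M x μ) (ν : Fin 4) {x : E}
    (hx : x ∈ spacelikeRegion) :
    ∑ ρ, x ρ * superpotential T b M ρ ν x = -α * component T (affineField b M x) (e ν) x := by
  have hc := fun b c => contDiffOn_component hT b c
  have h0 : ∀ μ, ∑ ρ, x ρ * fderiv ℝ (component T (e μ) (e ν)) x (e ρ) = 0 := fun μ => by
    rw [← clm_apply_eq_sum, fderiv_self_of_isHomogZero (hc _ _) (isHomogZero_component T _ _) hx]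
  simp only [superpotential, Finset.mul_sum]
  rw [Finset.sum_comm, component_eq_sum_left, Finset.mul_sum]
  refine Finset.sum_congr rfl fun μ _ => ?_
  have h1 := hα x μ
  calc ∑ ρ, x ρ * (affineField b M x μ * fderiv ℝ (component T (e μ) (e ν)) x (e ρ)
        - M μ ρ * component T (e μ) (e ν) x)
      = affineField b M x μ * ∑ ρ, x ρ * fderiv ℝ (component T (e μ) (e ν)) x (e ρ)
        - (∑ ρ, M μ ρ * x ρ) * component T (e μ) (e ν) x := by
        rw [Finset.mul_sum, Finset.sum_mul, ← Finset.sum_sub_distrib]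
        exact Finset.sum_congr rfl fun ρ _ => by ring
    _ = _ := by rw [h0, h1]; ring

theorem sum_mul_superpotential_right (hT : IsRegularSDT T) (ρ : Fin 4) {x : E}
    (hx : x ∈ spacelikeRegion) :
    ∑ ν, x ν * superpotential T b M ρ ν x = -component T (affineField b M x) (e ρ) x := by
  have hr := hT.regular
  have hs := hT.symm
  have h0 : ∀ μ, ∑ ν, x ν * fderiv ℝ (component T (e μ) (e ν)) x (e ρ) =
      -component T (e μ) (e ρ) x := fun μ => by
    simp only [fderiv_component_comm hs (e μ) _ hx]
    rw [← fderiv_component_eq_sum_left hr _ _ hx,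
      fderiv_component_self_left hr hT.tangential _ hx, component_comm hs _ _ hx]
  have h1 : ∀ μ, ∑ ν, x ν * component T (e μ) (e ν) x = 0 := fun μ => by
    rw [← component_eq_sum_right, component_comm hs _ _ hx, component_self_left hT.tangential _ hx]
  simp only [superpotential, Finset.mul_sum]
  rw [Finset.sum_comm, component_eq_sum_left, ← Finset.sum_neg_distrib]
  refine Finset.sum_congr rfl fun μ _ => ?_
  calc ∑ ν, x ν * (affineField b M x μ * fderiv ℝ (component T (e μ) (e ν)) x (e ρ)
        - M μ ρ * component T (e μ) (e ν) x)
      = affineField b M x μ * ∑ ν, x ν * fderiv ℝ (component T (e μ) (e ν)) x (e ρ)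
        - M μ ρ * ∑ ν, x ν * component T (e μ) (e ν) x := by
        rw [Finset.mul_sum, Finset.mul_sum, ← Finset.sum_sub_distrib]
        exact Finset.sum_congr rfl fun ρ _ => by ring
    _ = _ := by rw [h0, h1]; ring

/-- The cross terms of the product rule cancel; this is the purpose of the minus sign in
`superpotential`. -/
theorem divergence_superpotential_left (hT : IsRegular T) (ν : Fin 4) {x : E}
    (hx : x ∈ spacelikeRegion) :
    ∑ ρ, sgn ρ * superpotentialDeriv T b M ρ ν x (e ρ) =
      dAlembert (component T (affineField b M x) (e ν)) x := by
  rw [dAlembert_component_eq_sum_left hT _ _ hx]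
  simp only [superpotentialDeriv_apply b M hT _ _ hx, sum_mul_e, dAlembert, Finset.mul_sum]
  rw [Finset.sum_comm]
  exact Finset.sum_congr rfl fun μ _ => Finset.sum_congr rfl fun ρ _ => by ring

theorem sum_sgn_fderiv_fderiv_component (hT : IsRegularSDT T) (c : E) {x : E}
    (hx : x ∈ spacelikeRegion) (u : E) :
    ∑ ν, sgn ν * fderiv ℝ (fderiv ℝ (component T c (e ν))) x (e ν) u = 0 := by
  have hc := fun b c => contDiffOn_component hT.regular b c
  have h1 : HasFDerivAt (fun y => ∑ ν, sgn ν * fderiv ℝ (component T c (e ν)) y (e ν))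
      (∑ ν, sgn ν • fderiv ℝ (fun y => fderiv ℝ (component T c (e ν)) y (e ν)) x) x :=
    HasFDerivAt.fun_sum fun ν _ =>
      (differentiableAt_of_mem (contDiffOn_fderiv_apply (hc _ _) _) hx).hasFDerivAt.const_mul _
  have h2 : HasFDerivAt (fun y => ∑ ν, sgn ν * fderiv ℝ (component T c (e ν)) y (e ν))
      (0 : E →L[ℝ] ℝ) x := by
    refine (hasFDerivAt_const (0 : ℝ) x).congr_of_eventuallyEq ?_
    filter_upwards [spacelikeRegion_mem_nhds hx] with z hz
    simp only [fderiv_component_comm hT.symm c _ hz]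
    exact divergence_eq' hT hz c
  have h3 := congrArg (fun L : E →L[ℝ] ℝ => L u) (h1.unique h2)
  simp only [sum_apply, smul_apply, smul_eq_mul, zero_apply, fderiv_fderiv_apply (hc _ _) hx] at h3
  rw [← h3]
  exact Finset.sum_congr rfl fun ν _ => by rw [fderiv_fderiv_comm (hc _ _) hx]

/-- The cross term contracts the antisymmetric `M^{μν}` (the Killing condition `hanti`) with the
symmetric `T`; the other terms contain the divergence of `T`. -/
theorem divergence_superpotential_right (hT : IsRegularSDT T)
    (hanti : ∀ μ ν, sgn ν * M μ ν = -(sgn μ * M ν μ)) (ρ : Fin 4) {x : E}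
    (hx : x ∈ spacelikeRegion) :
    ∑ ν, sgn ν * superpotentialDeriv T b M ρ ν x (e ν) = 0 := by
  have h1 : ∀ μ, ∑ ν, sgn ν * fderiv ℝ (component T (e μ) (e ν)) x (e ν) = 0 := fun μ => by
    simp only [fderiv_component_comm hT.symm (e μ) _ hx]
    exact divergence_eq' hT hx (e μ)
  have h2 : ∑ μ, ∑ ν, sgn ν * M μ ν * fderiv ℝ (component T (e μ) (e ν)) x (e ρ) = 0 := by
    have h3 : ∑ μ, ∑ ν, sgn ν * M μ ν * fderiv ℝ (component T (e μ) (e ν)) x (e ρ) =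
        -∑ μ, ∑ ν, sgn ν * M μ ν * fderiv ℝ (component T (e μ) (e ν)) x (e ρ) := by
      conv_lhs => rw [Finset.sum_comm]
      simp only [← Finset.sum_neg_distrib]
      refine Finset.sum_congr rfl fun μ _ => Finset.sum_congr rfl fun ν _ => ?_
      rw [hanti ν μ, fderiv_component_comm hT.symm (e ν) _ hx, neg_mul]
    linarith
  simp only [superpotentialDeriv_apply b M hT.regular _ _ hx, sum_mul_e, Finset.mul_sum]
  rw [Finset.sum_comm]
  calc ∑ μ, ∑ ν, sgn ν * (affineField b M x μ *
          fderiv ℝ (fderiv ℝ (component T (e μ) (e ν))) x (e ν) (e ρ)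
        + fderiv ℝ (component T (e μ) (e ν)) x (e ρ) * M μ ν
        - M μ ρ * fderiv ℝ (component T (e μ) (e ν)) x (e ν))
      = ∑ μ, affineField b M x μ *
          ∑ ν, sgn ν * fderiv ℝ (fderiv ℝ (component T (e μ) (e ν))) x (e ν) (e ρ)
        + ∑ μ, ∑ ν, sgn ν * M μ ν * fderiv ℝ (component T (e μ) (e ν)) x (e ρ)
        - ∑ μ, M μ ρ * ∑ ν, sgn ν * fderiv ℝ (component T (e μ) (e ν)) x (e ν) := by
        simp only [Finset.mul_sum, ← Finset.sum_add_distrib, ← Finset.sum_sub_distrib]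
        exact Finset.sum_congr rfl fun μ _ => Finset.sum_congr rfl fun ν _ => by ring
    _ = 0 := by
        simp only [sum_sgn_fderiv_fderiv_component hT _ hx, h1, h2, mul_zero,
          Finset.sum_const_zero, add_zero, sub_zero]

end

/-! ### The dual one-form and the vanishing of the charge. -/

/-- The volume form with its two middle arguments fixed, as a bilinear form. -/
noncomputable def volOuter (a b : E) : E →L[ℝ] E →L[ℝ] ℝ :=
  ∑ μ, (volFst a b (e μ)).smulRight (ContinuousLinearMap.proj μ : E →L[ℝ] ℝ)

theorem volOuter_apply (a b y u : E) : volOuter a b y u = vol y a b u := by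
  simp only [volOuter, sum_apply, ContinuousLinearMap.smulRight_apply, smul_apply, volFst_apply,
    ContinuousLinearMap.proj_apply, smul_eq_mul]
  simp [Fin.sum_univ_four, vol_apply, e]
  ring

/-- The one-form `u ↦ vol(y, e^ρ, e^ν, u) C_{ρν}`. -/
noncomputable def dualForm (C : Fin 4 → Fin 4 → E → ℝ) (y : E) : E →L[ℝ] ℝ :=
  ∑ ρ, ∑ ν, (sgn ρ * sgn ν * C ρ ν y) • volOuter (e ρ) (e ν) y

theorem contDiffOn_dualForm {C : Fin 4 → Fin 4 → E → ℝ}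
    (hC : ∀ ρ ν, ContDiffOn ℝ ∞ (C ρ ν) spacelikeRegion) :
    ContDiffOn ℝ ∞ (dualForm C) spacelikeRegion :=
  ContDiffOn.sum fun ρ _ => ContDiffOn.sum fun ν _ =>
    (contDiffOn_const.mul (hC ρ ν)).smul (volOuter (e ρ) (e ν)).contDiff.contDiffOn

theorem fderiv_dualForm_apply {C : Fin 4 → Fin 4 → E → ℝ} {D : Fin 4 → Fin 4 → E →L[ℝ] ℝ} {x : E}
    (hC : ∀ ρ ν, HasFDerivAt (C ρ ν) (D ρ ν) x) (u v : E) :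
    fderiv ℝ (dualForm C) x u v = ∑ ρ, ∑ ν, sgn ρ * sgn ν *
      (vol u (e ρ) (e ν) v * C ρ ν x + vol x (e ρ) (e ν) v * D ρ ν u) := by
  have h : HasFDerivAt (dualForm C) (∑ ρ, ∑ ν, ((sgn ρ * sgn ν * C ρ ν x) • volOuter (e ρ) (e ν)
      + ((sgn ρ * sgn ν) • D ρ ν).smulRight (volOuter (e ρ) (e ν) x))) x :=
    HasFDerivAt.fun_sum fun ρ _ => HasFDerivAt.fun_sum fun ν _ =>
      ((hC ρ ν).const_mul _).smul (volOuter (e ρ) (e ν)).hasFDerivAt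
  rw [h.fderiv]
  simp only [sum_apply, add_apply, smul_apply, smul_eq_mul,
    ContinuousLinearMap.smulRight_apply, volOuter_apply]
  exact Finset.sum_congr rfl fun μ _ => Finset.sum_congr rfl fun ν _ => by ring

/-- The charge of a solution of the wave equation along a vector field which agrees with an affine
field `b + M y` up to a multiple of the normal vector. -/
theorem charge_eq_zero {T : TensorField 2} (hT : IsRegularSDT T) {m : ℝ}
    (hbox : ∀ x ∈ dS3, ∀ v w : E, box T x v w + m * T x ![v, w] = 0)
    {b : E} {M : Fin 4 → Fin 4 → ℝ} {α : ℝ}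
    (hα : ∀ x μ, ∑ ν, M μ ν * x ν = α * affineField b M x μ)
    (hM : ∀ μ ν, (α - 1) * M μ ν = 0) (hanti : ∀ μ ν, sgn ν * M μ ν = -(sgn μ * M ν μ))
    (hm : α ^ 2 - 1 - (m + 2) ≠ 0) {ξ : E → E}
    (hξ : ∀ x ∈ dS3, ∀ w, T x ![ξ x, w] = T x ![affineField b M x, w]) (S : CauchySurface) :
    charge T ξ S = 0 := by
  have hW := contDiffOn_dualForm fun ρ ν => contDiffOn_superpotential b M hT.regular ρ ν
  have hstokes := S.integral_exterior_deriv_eq_zero hW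
  have key : ∀ θ φ, ∑ μ, sgn μ * T (S.pt θ φ) ![ξ (S.pt θ φ), e μ] * vol (S.pt θ φ) (e μ)
        (fderiv ℝ S.param (θ, φ) (1, 0)) (fderiv ℝ S.param (θ, φ) (0, 1)) =
      -(α ^ 2 - 1 - (m + 2))⁻¹ * (fderiv ℝ (dualForm (superpotential T b M)) (S.param (θ, φ))
          (fderiv ℝ S.param (θ, φ) (1, 0)) (fderiv ℝ S.param (θ, φ) (0, 1))
        - fderiv ℝ (dualForm (superpotential T b M)) (S.param (θ, φ))
          (fderiv ℝ S.param (θ, φ) (0, 1)) (fderiv ℝ S.param (θ, φ) (1, 0))) := by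
    intro θ φ
    have hx := S.param_mem (θ, φ)
    have hx' := dS3_subset_spacelikeRegion hx
    have hu := S.eta_fderiv_param (θ, φ) (1, 0)
    have hv := S.eta_fderiv_param (θ, φ) (0, 1)
    rw [show S.pt θ φ = S.param (θ, φ) from rfl]
    set x := S.param (θ, φ)
    set u := fderiv ℝ S.param (θ, φ) (1, 0)
    set v := fderiv ℝ S.param (θ, φ) (0, 1)
    have hC := fun ρ ν => hasFDerivAt_superpotential b M hT.regular ρ ν hx'
    -- With `k = α - 1` and `l = -(m + 2)` the factor `(2 + k)(α - 1) + l` equals `α² - 1 - (m +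
    -- 2)`.
    have h := sum_vol_antisymm_deriv_eq_flux (fun ρ ν => superpotential T b M ρ ν x)
      (fun ρ ν => superpotentialDeriv T b M ρ ν x)
      (fun ν => component T (affineField b M x) (e ν) x) x u v (α - 1) α (-(m + 2))
      (fun ρ ν => superpotentialDeriv_self hT.regular hα hM ρ ν hx') hx hu hv
      (fun ν => sum_mul_superpotential_left hT.regular hα ν hx')
      (fun ρ => sum_mul_superpotential_right hT ρ hx')
      (fun ν => by
        rw [divergence_superpotential_left hT.regular ν hx',
          dAlembert_component_of_box hT hx m (hbox x hx)])
      (fun ρ => divergence_superpotential_right hT hanti ρ hx')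
    have h2 : fderiv ℝ (dualForm (superpotential T b M)) x u v
        - fderiv ℝ (dualForm (superpotential T b M)) x v u =
        (α ^ 2 - 1 - (m + 2)) * ∑ ν, sgn ν * component T (affineField b M x) (e ν) x
          * vol x (e ν) v u := by
      rw [fderiv_dualForm_apply hC, fderiv_dualForm_apply hC]
      simp only [mul_sub, Finset.sum_sub_distrib] at h ⊢
      rw [h]; ring
    rw [h2, neg_mul, inv_mul_cancel_left₀ hm, ← Finset.sum_neg_distrib]
    refine Finset.sum_congr rfl fun μ _ => ?_
    rw [hξ x hx, vol_swap_last x (e μ) u v, component, retr_of_mem hx]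
    ring
  rw [charge_eq_integral_vol]
  simp only [key, intervalIntegral.integral_const_mul, hstokes, mul_zero]

/-! ### Translations and Killing vectors. -/

theorem translation_apply (l : Fin 4) {x : E} (hx : x ∈ dS3) :
    translation l x = (sgn l • e l : E) - x l • x := by
  have h : HasFDerivAt (fun y => zeta l (retr y))
      ((ContinuousLinearMap.proj l : E →L[ℝ] ℝ).comp (tanProj x)) x :=
    (ContinuousLinearMap.proj l : E →L[ℝ] ℝ).hasFDerivAt.comp x (hasFDerivAt_retr hx)
  ext μ
  rw [translation, grad, h.fderiv]
  simp only [ContinuousLinearMap.comp_apply, tanProj_tanProj hx, ContinuousLinearMap.proj_apply]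
  simp only [tanProj_apply, eta_e, Pi.sub_apply, Pi.smul_apply, smul_eq_mul]
  simp only [e, Pi.single_apply]
  have h1 := sgn_mul_self μ
  rcases eq_or_ne l μ with rfl | h2
  · simp only [if_true]
    linear_combination (-x l * x l) * h1
  · simp only [if_neg h2, if_neg h2.symm]
    linear_combination (-x μ * x l) * h1

/-- A translation differs from a constant field by a normal vector, so `α = 0` and the factor is
`-(m + 3)`. -/
theorem charge_translation_eq_zero {T : TensorField 2} (hT : IsRegularSDT T) {m : ℝ}
    (hbox : ∀ x ∈ dS3, ∀ v w : E, box T x v w + m * T x ![v, w] = 0) (hm : m ≠ -3) (l : Fin 4)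
    (S : CauchySurface) : charge T (translation l) S = 0 := by
  refine charge_eq_zero hT hbox (b := sgn l • e l) (M := fun _ _ => 0) (α := 0)
    (fun x μ => by simp) (by simp) (by simp) (fun h => hm (by linarith)) (fun x hx w => ?_) S
  have h := component_sub_smul hT.tangential (x l) (sgn l • e l) w (dS3_subset_spacelikeRegion hx)
  simp only [component, retr_of_mem hx] at h
  rw [translation_apply l hx, h]
  congr
  ext μ
  simp [affineField]

/-- The vanishing of the charges along the linear vector fields which generate Lorentz
transformations. -/
theorem charge_linear_eq_zero {T : TensorField 2} (hT : IsRegularSDT T) {m : ℝ}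
    (hbox : ∀ x ∈ dS3, ∀ v w : E, box T x v w + m * T x ![v, w] = 0) (hm : m ≠ -2)
    {ξ : E → E} (M : Fin 4 → Fin 4 → ℝ) (hξ : ∀ x μ, ξ x μ = ∑ ν, M μ ν * x ν)
    (hanti : ∀ μ ν, sgn ν * M μ ν = -(sgn μ * M ν μ)) (S : CauchySurface) :
    charge T ξ S = 0 := by
  have h : ∀ x, affineField 0 M x = ξ x := fun x => by
    ext μ; simp [affineField, hξ]
  exact charge_eq_zero hT hbox (b := 0) (M := M) (α := 1)
    (fun x μ => by rw [h, hξ, one_mul]) (by simp) hanti (fun h => hm (by linarith))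
    (fun x hx w => by rw [h]) S

end DeSitter

theorem lemma5 (n : ℤ) (hn : 3 ≤ n) (T : DeSitter.TensorField 2)
    (hT : DeSitter.IsRegularSDT T)
    (hbox : ∀ x ∈ DeSitter.dS3, ∀ v w : DeSitter.E,
      DeSitter.box T x v w + ((n : ℝ) ^ 2 - 2 * (n : ℝ) - 2) * T x ![v, w] = 0)
    (S : DeSitter.CauchySurface) :
    (∀ l : Fin 4, DeSitter.charge T (DeSitter.translation l) S = 0) ∧
    (∀ k : Fin 3, DeSitter.charge T (DeSitter.rotation k) S = 0) ∧
    (∀ k : Fin 3, DeSitter.charge T (DeSitter.boost k) S = 0) := by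
  have hn' : (3 : ℝ) ≤ n := by exact_mod_cast hn
  -- The two excluded values amount to `(n - 1)² = 0` and `n(n - 2) = 0`.
  have h1 : (n : ℝ) ^ 2 - 2 * (n : ℝ) - 2 ≠ -3 := by nlinarith
  have h2 : (n : ℝ) ^ 2 - 2 * (n : ℝ) - 2 ≠ -2 := by nlinarith
  refine ⟨fun l => DeSitter.charge_translation_eq_zero hT hbox h1 l S, fun k => ?_, fun k => ?_⟩
  · refine DeSitter.charge_linear_eq_zero hT hbox h2
      -- The columns of the matrix of a linear field are its values on the basis vectors.
      (fun μ ν => DeSitter.rotation k (DeSitter.e ν) μ) (fun x μ => ?_) (fun μ ν => ?_) S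
    · fin_cases k <;> fin_cases μ <;>
        simp [DeSitter.rotation, DeSitter.e, Fin.sum_univ_four]
    · fin_cases k <;> fin_cases μ <;> fin_cases ν <;>
        simp [DeSitter.rotation, DeSitter.e, DeSitter.sgn]
  · refine DeSitter.charge_linear_eq_zero hT hbox h2
      (fun μ ν => DeSitter.boost k (DeSitter.e ν) μ) (fun x μ => ?_) (fun μ ν => ?_) S
    · fin_cases k <;> fin_cases μ <;>
        simp [DeSitter.boost, DeSitter.e, Fin.sum_univ_four]
    · fin_cases k <;> fin_cases μ <;> fin_cases ν <;>
        simp [DeSitter.boost, DeSitter.e, DeSitter.sgn]
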